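/- Let $n\ge 1$, let $\mathbb B_n$ be the open unit ball of $\mathbb C^n$ and let $dv$ be Lebesgue measure on $\mathbb B_n$, normalized so that $v(\mathbb B_n)=1$. Let $1<p<\infty$, $\frac1p+\frac1{p'}=1$, and let $A^p$ be the Bergman space of holomorphic functions in $L^p(\mathbb B_n,dv)$. Put $\langle f,g\rangle=\int_{\mathbb B_n} f\,\overline g\,dv$ and $$K_z(w)=\frac1{(1-\langle w,z\rangle_{\mathbb C^n})^{n+1}},\qquad k_z=(1-|z|^2)^{\frac{n+1}2}K_z,\qquad d\lambda(z)=\frac{dv(z)}{(1-|z|^2)^{n+1}},$$ where $\langle w,z\rangle_{\mathbb C^n}=\sum_i w_i\overline{z_i}$, and let $\|K_z\|$ be the norm of $K_z$ in $A^2$. Let $\varphi_z$ be the Möbius involution of $\mathbb B_n$ interchanging $0$ and $z$, $\rho(z,w)=|\varphi_z(w)|$, $\beta(z,w)=\frac12\log\frac{1+\rho(z,w)}{1-\rho(z,w)}$ the Bergman metric, and $D(z,r)=\{w\in\mathbb B_n:\beta(z,w)\le r\}$. A bounded operator $T$ on $A^p$ is called $p$ weakly localized, $T\in\mathcal A_p(\mathbb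 B_n)$, if (i) there is $0<\delta<\min\{p,p'\}$ with $$\sup_{z\in\mathbb B_n}\int_{\mathbb B_n}|\langle Tk_z,k_w\rangle|\,\frac{\|K_z\|^{1-\frac{2\delta}{p'(n+1)}}}{\|K_w\|^{1-\frac{2\delta}{p'(n+1)}}}\,d\lambda(w)<\infty,\qquad \sup_{z\in\mathbb B_n}\int_{\mathbb B_n}|\langle T^*k_z,k_w\rangle|\,\frac{\|K_z\|^{1-\frac{2\delta}{p(n+1)}}}{\|K_w\|^{1-\frac{2\delta}{p(n+1)}}}\,d\lambda(w)<\infty,$$ where $\langle T^*k_z,k_w\rangle=\langle k_z,Tk_w\rangle$; and (ii) there is $0<\delta<\min\{p,p'\}$ such that the same two suprema, with the integrals taken over $\mathbb B_n\setminus D(z,r)$ instead of $\mathbb B_n$, tend to $0$ as $r\to\infty$. Then the Bergman projection $Pf(z)=\int_{\mathbb B_n}K_w(z)f(w)\,dv(w)$ is a bounded operator from $L^p(\mathbb B_n,dv)$ to $A^p$, and the following holds. Let $T$ be in the closure of $\mathcal A_p(\mathbb B_n)$ in the operator norm of the bounded operators on $A^p$, let $N\in\mathbb N$ and let $\epsilon>0$.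 Then there is $r>0$ such that for every countable covering $\{F_j\}$ of $\mathbb B_n$ by pairwise disjoint Borel subsets of $\mathbb B_n$ for which every point of $\mathbb B_n$ belongs to at most $N$ of the sets $G_j=\{z\in\mathbb B_n:\beta(z,F_j)\le r\}$ (where $\beta(z,F)=\inf_{w\in F}\beta(z,w)$), the series $\sum_j M_{1_{F_j}}TPM_{1_{G_j}}f$ converges unconditionally in $L^p(\mathbb B_n,dv)$ for every $f\in A^p$, its sum defines a bounded operator from $A^p$ to $L^p(\mathbb B_n,dv)$, and $$\Big\|TP-\sum_j M_{1_{F_j}}TPM_{1_{G_j}}\Big\|_{A^p\to L^p(\mathbb B_n,dv)}<\epsilon .$$ Here $M_{1_E}$ is multiplication by the indicator function of $E$. -/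

import Mathlib

open MeasureTheory Filter Topology
open scoped ENNReal

noncomputable section

namespace Bergman

/-- The space `ℂⁿ` with its Euclidean norm. -/
abbrev Cn (n : ℕ) : Type := EuclideanSpace ℂ (Fin n)

/-- The open unit ball of `ℂⁿ`. -/
def unitBall (n : ℕ) : Set (Cn n) := Metric.ball 0 1

/-- The measure `dv`: Lebesgue measure on the unit ball, normalized to have total mass one
(this is the normalization for which `K z w = (1 - ⟨w, z⟩)⁻⁽ⁿ⁺¹⁾` is the reproducing kernel). -/
def vol (n : ℕ) : Measure (Cn n) :=
  (volume (unitBall n))⁻¹ • (volume : Measure (Cn n)).restrict (unitBall n)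

/-- The invariant measure `dλ(z) = dv(z) / (1 - |z|²)ⁿ⁺¹`. -/
def invVol (n : ℕ) : Measure (Cn n) :=
  (vol n).withDensity fun z => ENNReal.ofReal (((1 - ‖z‖ ^ 2) ^ (n + 1))⁻¹)

/-- The Bergman kernel `K_z(w) = (1 - \bar z w)⁻⁽ⁿ⁺¹⁾`; note `inner ℂ z w = ∑ i, conj (z i) * w i`. -/
def K {n : ℕ} (z w : Cn n) : ℂ := ((1 - inner ℂ z w) ^ (n + 1))⁻¹

/-- The normalized reproducing kernel `k_z(w) = (1 - |z|²)^{(n+1)/2} / (1 - \bar z w)ⁿ⁺¹`. -/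
def k {n : ℕ} (z w : Cn n) : ℂ :=
  (((1 - ‖z‖ ^ 2) ^ (((n : ℝ) + 1) / 2) : ℝ) : ℂ) * K z w

/-- The norm `‖K_z‖` in `A²`. -/
def normK {n : ℕ} (z : Cn n) : ℝ := (eLpNorm (K z) 2 (vol n)).toReal

/-- The pairing `⟨f, g⟩ = ∫ f \bar g dv`. -/
def pairing {n : ℕ} (f g : Cn n → ℂ) : ℂ := ∫ x, f x * (starRingEnd ℂ) (g x) ∂(vol n)

/-- The Möbius map `φ_z` of the ball interchanging `0` and `z`:
`φ_z(w) = (z - P_z w - √(1-|z|²) (w - P_z w)) / (1 - ⟨w, z⟩)`, where `P_z` is the orthogonal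
projection onto the span of `z`. -/
def moebius {n : ℕ} (z w : Cn n) : Cn n :=
  (1 - inner ℂ z w)⁻¹ •
    (z - (inner ℂ z w / inner ℂ z z) • z
      - ((Real.sqrt (1 - ‖z‖ ^ 2) : ℝ) : ℂ) • (w - (inner ℂ z w / inner ℂ z z) • z))

/-- The pseudohyperbolic metric. -/
def rho {n : ℕ} (z w : Cn n) : ℝ := ‖moebius z w‖

/-- The Bergman metric. -/
def beta {n : ℕ} (z w : Cn n) : ℝ := 1 / 2 * Real.log ((1 + rho z w) / (1 - rho z w))

/-- The closed hyperbolic ball `D(z, r)`. -/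
def D {n : ℕ} (z : Cn n) (r : ℝ) : Set (Cn n) := {w ∈ unitBall n | beta z w ≤ r}

/-- The distance of `z` to the set `F` in the Bergman metric (infinite when `F` is empty). -/
def distTo {n : ℕ} (F : Set (Cn n)) (z : Cn n) : ℝ≥0∞ := ⨅ w ∈ F, ENNReal.ofReal (beta w z)

/-- The `r`-neighbourhood `{z ∈ B : d(z, F) ≤ r}` of `F` in the Bergman metric. -/
def nhd {n : ℕ} (r : ℝ) (F : Set (Cn n)) : Set (Cn n) :=
  {z ∈ unitBall n | distTo F z ≤ ENNReal.ofReal r}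

/-! Helper facts -/

theorem volume_unitBall_ne_zero (n : ℕ) : volume (unitBall n) ≠ 0 :=
  (Metric.measure_ball_pos _ _ one_pos).ne'

instance instIsFiniteMeasureVol (n : ℕ) : IsFiniteMeasure (vol n) := by
  constructor
  rw [vol, Measure.smul_apply, Measure.restrict_apply_univ, smul_eq_mul]
  exact ENNReal.mul_lt_top (ENNReal.inv_lt_top.2 (volume_unitBall_ne_zero n).bot_lt)
    measure_ball_lt_top

theorem ae_mem_unitBall (n : ℕ) : ∀ᵐ z ∂(vol n), z ∈ unitBall n :=
  Measure.ae_smul_measure (ae_restrict_mem Metric.isOpen_ball.measurableSet) _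

theorem norm_inner_lt_one {n : ℕ} {z w : Cn n} (hz : z ∈ unitBall n) (hw : w ∈ unitBall n) :
    ‖inner ℂ z w‖ < 1 := by
  simp only [unitBall, Metric.mem_ball, dist_zero_right] at hz hw
  calc ‖inner ℂ z w‖ ≤ ‖z‖ * ‖w‖ := norm_inner_le_norm _ _
    _ < 1 := by nlinarith [norm_nonneg z, norm_nonneg w]

theorem one_sub_inner_ne_zero {n : ℕ} {z w : Cn n} (hz : z ∈ unitBall n) (hw : w ∈ unitBall n) :
    (1 - inner ℂ z w : ℂ) ≠ 0 := by
  intro h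
  have h1 := norm_inner_lt_one hz hw
  rw [← sub_eq_zero.1 h] at h1
  simp at h1

theorem norm_sq_moebius_aux {n : ℕ} {z w : Cn n} (hz : z ∈ unitBall n) :
    ‖z - (inner ℂ z w / inner ℂ z z) • z
      - ((Real.sqrt (1 - ‖z‖ ^ 2) : ℝ) : ℂ) • (w - (inner ℂ z w / inner ℂ z z) • z)‖ ^ 2
      = ‖(1 - inner ℂ z w : ℂ)‖ ^ 2 - (1 - ‖z‖ ^ 2) * (1 - ‖w‖ ^ 2) := by
  set t : ℂ := inner ℂ z w with ht
  set c : ℂ := t / inner ℂ z z with hc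
  have hzz : (inner ℂ z z : ℂ) = ((‖z‖ ^ 2 : ℝ) : ℂ) := by
    rw [inner_self_eq_norm_sq_to_K]; push_cast; rfl
  have htc : t = c * ((‖z‖ ^ 2 : ℝ) : ℂ) := by
    rcases eq_or_ne z 0 with h | h
    · simp [ht, h]
    · rw [hc, hzz, div_mul_cancel₀]
      exact_mod_cast pow_ne_zero 2 (norm_ne_zero_iff.2 h)
  have hzq : (inner ℂ z (w - c • z) : ℂ) = 0 := by
    rw [inner_sub_right, inner_smul_right, hzz, ← ht, ← htc, sub_self]
  have h1 : ‖w‖ ^ 2 = ‖w - c • z‖ ^ 2 + ‖c‖ ^ 2 * ‖z‖ ^ 2 := by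
    have h := norm_add_sq (𝕜 := ℂ) (w - c • z) (c • z)
    rw [inner_smul_right, ← inner_conj_symm, hzq, sub_add_cancel, norm_smul] at h
    simp only [map_zero, mul_zero] at h
    rw [h]; ring
  have h2 : z - c • z = (1 - c) • z := by rw [sub_smul, one_smul]
  have hz1 : ‖z‖ < 1 := by simpa [unitBall] using hz
  have hs : (Real.sqrt (1 - ‖z‖ ^ 2)) ^ 2 = 1 - ‖z‖ ^ 2 :=
    Real.sq_sqrt (by nlinarith [norm_nonneg z])
  rw [norm_sub_sq (𝕜 := ℂ), h2, inner_smul_right, inner_smul_left, hzq, norm_smul, norm_smul,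
    Complex.norm_real, Real.norm_eq_abs, mul_pow, mul_pow, sq_abs, hs, h1, htc]
  simp only [mul_zero, map_zero, Complex.sq_norm, Complex.normSq_apply, Complex.sub_re,
    Complex.sub_im, Complex.one_re, Complex.one_im, Complex.re_mul_ofReal, Complex.im_mul_ofReal]
  ring

theorem rho_lt_one {n : ℕ} {z w : Cn n} (hz : z ∈ unitBall n) (hw : w ∈ unitBall n) :
    rho z w < 1 := by
  have h0 := norm_pos_iff.2 (one_sub_inner_ne_zero hz hw)
  have hm := norm_sq_moebius_aux (w := w) hz
  simp only [unitBall, Metric.mem_ball, dist_zero_right] at hz hw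
  have h1 : 0 < (1 - ‖z‖ ^ 2) * (1 - ‖w‖ ^ 2) :=
    mul_pos (by nlinarith [norm_nonneg z]) (by nlinarith [norm_nonneg w])
  rw [rho, moebius, norm_smul, norm_inv, inv_mul_lt_one₀ h0]
  exact lt_of_pow_lt_pow_left₀ 2 h0.le (by linarith)

theorem continuousOn_rho {n : ℕ} {z : Cn n} (hz : z ∈ unitBall n) :
    ContinuousOn (fun w => rho z w) (unitBall n) := by
  unfold rho moebius
  refine (ContinuousOn.smul (ContinuousOn.inv₀ (by fun_prop)
    fun w hw => one_sub_inner_ne_zero hz hw) ?_).norm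
  fun_prop

theorem continuousOn_beta {n : ℕ} {z : Cn n} (hz : z ∈ unitBall n) :
    ContinuousOn (fun w => beta z w) (unitBall n) := by
  unfold beta
  have h := continuousOn_rho hz
  refine continuousOn_const.mul (ContinuousOn.log (ContinuousOn.div (continuousOn_const.add h)
    (continuousOn_const.sub h) fun w hw => ?_) fun w hw => ?_)
  · exact (sub_pos.2 (rho_lt_one hz hw)).ne'
  · exact (div_pos (add_pos_of_pos_of_nonneg one_pos (norm_nonneg _))
      (sub_pos.2 (rho_lt_one hz hw))).ne'

theorem measurableSet_nhd {n : ℕ} (r : ℝ) {F : Set (Cn n)} (hF : F ⊆ unitBall n) :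
    MeasurableSet (nhd r F) := by
  have hB : IsOpen (unitBall n) := Metric.isOpen_ball
  have hO : ∀ a : ℝ≥0∞, IsOpen {z ∈ unitBall n | distTo F z < a} := by
    intro a
    have : {z ∈ unitBall n | distTo F z < a}
        = ⋃ w ∈ F, unitBall n ∩ (fun z => ENNReal.ofReal (beta w z)) ⁻¹' Set.Iio a := by
      ext z
      simp only [distTo, iInf_lt_iff, Set.mem_ofPred_eq, Set.mem_iUnion, Set.mem_inter_iff,
        Set.mem_preimage, Set.mem_Iio, exists_prop]
      constructor
      · rintro ⟨h1, w, h2, h3⟩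
        exact ⟨w, h2, h1, h3⟩
      · rintro ⟨w, h2, h1, h3⟩
        exact ⟨h1, w, h2, h3⟩
    rw [this]
    refine isOpen_biUnion fun w hw => ?_
    exact (ENNReal.continuous_ofReal.comp_continuousOn (continuousOn_beta (hF hw))).isOpen_inter_preimage
      hB isOpen_Iio
  have : nhd r F = ⋂ m : ℕ, {z ∈ unitBall n | distTo F z < ENNReal.ofReal r + ((m : ℝ≥0∞) + 1)⁻¹} := by
    ext z
    simp only [nhd, Set.mem_ofPred_eq, Set.mem_iInter]
    constructor
    · rintro ⟨h1, h2⟩ m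
      refine ⟨h1, h2.trans_lt (ENNReal.lt_add_right ENNReal.ofReal_ne_top ?_)⟩
      exact ENNReal.inv_ne_zero.2 (by simp)
    · intro h
      refine ⟨(h 0).1, ENNReal.le_of_forall_pos_le_add fun ε hε _ => ?_⟩
      obtain ⟨m, hm⟩ := ENNReal.exists_inv_nat_lt (a := (ε : ℝ≥0∞)) (by simpa using hε.ne')
      refine (h m).2.le.trans (add_le_add le_rfl (le_trans ?_ hm.le))
      exact ENNReal.inv_le_inv.2 le_self_add
  rw [this]
  exact MeasurableSet.iInter fun m => (hO _).measurableSet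

/-! The Bergman space and the operators on it -/

/-- The Lebesgue space `Lᵖ(B, dv)`. -/
abbrev LpBall (n : ℕ) (p : ℝ≥0∞) := Lp ℂ p (vol n)

/-- The Bergman space `Aᵖ`, as the subspace of the (classes of) functions in `Lᵖ(B, dv)` that are
holomorphic on the ball. -/
def bergmanSpace (n : ℕ) (p : ℝ≥0∞) : Submodule ℂ (LpBall n p) where
  carrier := {f | ∃ g : Cn n → ℂ, DifferentiableOn ℂ g (unitBall n) ∧ f =ᵐ[vol n] g}
  add_mem' := by
    rintro f₁ f₂ ⟨g₁, h₁, e₁⟩ ⟨g₂, h₂, e₂⟩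
    exact ⟨g₁ + g₂, h₁.add h₂, (Lp.coeFn_add f₁ f₂).trans (e₁.add e₂)⟩
  zero_mem' := ⟨0, differentiableOn_const 0, Lp.coeFn_zero _ _ _⟩
  smul_mem' := by
    rintro c f ⟨g, h, e⟩
    exact ⟨c • g, h.const_smul c, (Lp.coeFn_smul c f).trans (e.const_smul c)⟩

theorem differentiableOn_k {n : ℕ} {z : Cn n} (hz : z ∈ unitBall n) :
    DifferentiableOn ℂ (k z) (unitBall n) := by
  unfold k K
  have h : DifferentiableOn ℂ (fun w : Cn n => (1 - inner ℂ z w : ℂ)) (unitBall n) :=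
    (differentiableOn_const 1).sub (innerSL ℂ z).differentiable.differentiableOn
  exact ((h.pow (n + 1)).inv fun w hw => pow_ne_zero _ (one_sub_inner_ne_zero hz hw)).const_mul _

theorem memLp_k {n : ℕ} (p : ℝ≥0∞) {z : Cn n} (hz : z ∈ unitBall n) : MemLp (k z) p (vol n) := by
  refine MemLp.of_bound ?_ (‖(((1 - ‖z‖ ^ 2) ^ (((n : ℝ) + 1) / 2) : ℝ) : ℂ)‖
    * ((1 - ‖z‖) ^ (n + 1))⁻¹) ?_
  · exact ((differentiableOn_k hz).continuousOn.aestronglyMeasurable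
      Metric.isOpen_ball.measurableSet).smul_measure _
  · filter_upwards [ae_mem_unitBall n] with w hw
    simp only [unitBall, Metric.mem_ball, dist_zero_right] at hz hw
    have h1 : 1 - ‖z‖ ≤ ‖(1 - inner ℂ z w : ℂ)‖ := by
      have h2 : ‖(inner ℂ z w : ℂ)‖ ≤ ‖z‖ := (norm_inner_le_norm z w).trans
        (mul_le_of_le_one_right (norm_nonneg z) hw.le)
      have h3 := norm_sub_norm_le (1 : ℂ) (inner ℂ z w)
      rw [norm_one] at h3
      linarith
    rw [k, K, norm_mul, norm_inv, norm_pow]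
    have h4 : 0 < 1 - ‖z‖ := sub_pos.2 hz
    gcongr

/-- The normalized kernel `k_z` as an element of `Aᵖ`, for `z` in the ball
(and, as a convention without effect, zero for `z` outside of the ball). -/
def kernel (n : ℕ) (p : ℝ≥0∞) (z : Cn n) : bergmanSpace n p :=
  open Classical in
  if hz : z ∈ unitBall n then
    ⟨(memLp_k p hz).toLp (k z), k z, differentiableOn_k hz, (memLp_k p hz).coeFn_toLp⟩
  else 0

section Localized

variable {n : ℕ} {p : ℝ≥0∞} [Fact (1 ≤ p)]

/-- The number `⟨T k_z, k_w⟩`. -/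
def entry (T : bergmanSpace n p →L[ℂ] bergmanSpace n p) (z w : Cn n) : ℂ :=
  pairing (T (kernel n p z) : LpBall n p) (k w)

/-- The number `⟨T* k_z, k_w⟩ = ⟨k_z, T k_w⟩`, where `T*` is the adjoint of `T` with respect to
the pairing `⟨f, g⟩ = ∫ f \bar g dv` of `Aᵖ` and its dual. -/
def adjEntry (T : bergmanSpace n p →L[ℂ] bergmanSpace n p) (z w : Cn n) : ℂ :=
  pairing (k z) (T (kernel n p w) : LpBall n p)

/-- `∫_E |M(z, w)| ‖K_z‖ᵃ / ‖K_w‖ᵃ dλ(w)`. -/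
def schurInt (M : Cn n → Cn n → ℂ) (a : ℝ) (z : Cn n) (E : Set (Cn n)) : ℝ≥0∞ :=
  ∫⁻ w in E, ENNReal.ofReal (‖M z w‖ * (normK z ^ a / normK w ^ a)) ∂(invVol n)

/-- The exponent `1 - 2δ / (q (n + 1))`. -/
def expo (n : ℕ) (q δ : ℝ) : ℝ := 1 - 2 * δ / (q * (n + 1))

/-- `p`-weakly localized operators on `Aᵖ`; here `p.toReal.conjExponent` is the exponent `p'`
with `1/p + 1/p' = 1`. -/
structure IsWeaklyLocalized (T : bergmanSpace n p →L[ℂ] bergmanSpace n p) : Prop where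
  bounded : ∃ δ : ℝ, 0 < δ ∧ δ < min p.toReal p.toReal.conjExponent ∧
    (⨆ z ∈ unitBall n,
      schurInt (entry T) (expo n p.toReal.conjExponent δ) z (unitBall n)) < ⊤ ∧
    (⨆ z ∈ unitBall n,
      schurInt (adjEntry T) (expo n p.toReal δ) z (unitBall n)) < ⊤
  vanishing : ∃ δ : ℝ, 0 < δ ∧ δ < min p.toReal p.toReal.conjExponent ∧
    Tendsto (fun r : ℝ => ⨆ z ∈ unitBall n,
      schurInt (entry T) (expo n p.toReal.conjExponent δ) z (unitBall n \ D z r)) atTop (𝓝 0) ∧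
    Tendsto (fun r : ℝ => ⨆ z ∈ unitBall n,
      schurInt (adjEntry T) (expo n p.toReal δ) z (unitBall n \ D z r)) atTop (𝓝 0)

/-- The class of the `p`-weakly localized operators, inside the bounded operators on `Aᵖ`. -/
def weaklyLocalized (n : ℕ) (p : ℝ≥0∞) [Fact (1 ≤ p)] :
    Set (bergmanSpace n p →L[ℂ] bergmanSpace n p) :=
  {T | IsWeaklyLocalized T}

/-- `P` is the Bergman projection, i.e. the bounded operator from `Lᵖ(B, dv)` to `Aᵖ` given by
`P f (z) = ∫ K_w(z) f(w) dv(w)`. -/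
def IsBergmanProjection (P : LpBall n p →L[ℂ] bergmanSpace n p) : Prop :=
  ∀ f : LpBall n p, (P f : LpBall n p) =ᵐ[vol n] fun z => ∫ w, K w z * f w ∂(vol n)

/-- The operator `M_{1_E}` of multiplication by the indicator function of `E` on `Lᵖ(B, dv)`. -/
def mulInd (E : Set (Cn n)) (hE : MeasurableSet E) : LpBall n p →L[ℂ] LpBall n p :=
  LinearMap.mkContinuous
    { toFun := fun f => ((Lp.memLp f).indicator hE).toLp (E.indicator f)
      map_add' := fun f g => by
        rw [← MemLp.toLp_add]
        refine MemLp.toLp_congr _ _ ?_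
        filter_upwards [Lp.coeFn_add f g] with x hx
        rw [Pi.add_apply] at hx ⊢
        by_cases h : x ∈ E <;> simp only [h, Set.indicator_of_mem, Set.indicator_of_notMem,
          not_false_eq_true, hx, add_zero]
      map_smul' := fun c f => by
        rw [RingHom.id_apply, ← MemLp.toLp_const_smul]
        refine MemLp.toLp_congr _ _ ?_
        filter_upwards [Lp.coeFn_smul c f] with x hx
        rw [Pi.smul_apply] at hx ⊢
        by_cases h : x ∈ E <;> simp only [h, Set.indicator_of_mem, Set.indicator_of_notMem,
          not_false_eq_true, hx, smul_zero] }
    1 (fun f => by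
      rw [one_mul, LinearMap.coe_mk, AddHom.coe_mk, Lp.norm_toLp, Lp.norm_def]
      exact ENNReal.toReal_mono (Lp.eLpNorm_ne_top f) (eLpNorm_indicator_le _))

end Localized

/-- Coverings `{F_j}` of the ball by disjoint Borel sets such that every point of the ball belongs
to at most `N` of the `r`-neighbourhoods `G_j = {z ∈ B : d(z, F_j) ≤ r}`. Finite families
are included by letting all but finitely many of the `F_j` be empty (then `G_j` is empty). -/
structure IsBorelCovering (n N : ℕ) (r : ℝ) (F : ℕ → Set (Cn n)) : Prop where
  measurable : ∀ j, MeasurableSet (F j)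
  disjoint : Pairwise fun i j => Disjoint (F i) (F j)
  cover : ⋃ j, F j = unitBall n
  multiplicity : ∀ z ∈ unitBall n, {j | z ∈ nhd r (F j)}.encard ≤ N

theorem IsBorelCovering.subset {n N : ℕ} {r : ℝ} {F : ℕ → Set (Cn n)}
    (h : IsBorelCovering n N r F) (j : ℕ) : F j ⊆ unitBall n :=
  h.cover ▸ Set.subset_iUnion F j

end Bergman

end

/-!
The operator `TP` has the kernel `(z, w) ↦ (T K_w)(z)`, where `K_w` is the reproducing kernel of the
ball. For functions supported in a smaller ball this is a Bochner integral of `w ↦ f(w) K_w` in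
`Aᵖ`; the general case follows by density. The normalization of `k_z` and the weights
in the definition of weak localization combine to a Schur test for this kernel with test functions
`(1 - |w|²)^(-δ/q)`, and condition (ii) says that the part of the kernel with `β(z, w) > r` passes
the test with a constant tending to zero as `r → ∞`.

Almost everywhere on `F_j` the difference of `TP` and the sum applied to `f` agrees with
`TP(1 - M_{1_{G_j}})f`, which only involves that far part of the kernel. So the norm of the
difference is small as soon as `r` is large, uniformly in the covering. Since the `F_j` are disjoint
and the `G_j` overlap at most `N` times, the block sum of any bounded operator `A` on `Lᵖ` has norm
at most `N^(1/p) ‖A‖`, and the estimate therefore passes to limits in the operator norm.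
-/

noncomputable section

namespace Bergman

/-! ### Möbius maps -/

section Moebius

variable {n : ℕ} {z w : Cn n}

theorem mem_unitBall : z ∈ unitBall n ↔ ‖z‖ < 1 :=
  mem_ball_zero_iff

theorem measurableSet_unitBall (n : ℕ) : MeasurableSet (unitBall n) :=
  Metric.isOpen_ball.measurableSet

theorem one_sub_norm_sq_pos (hz : z ∈ unitBall n) : 0 < 1 - ‖z‖ ^ 2 := by
  rw [mem_unitBall] at hz
  nlinarith [norm_nonneg z]

/-- The number `s_z = √(1 - |z|²)` from the formula for `φ_z`, as a complex number. -/
def defect (z : Cn n) : ℂ :=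
  (Real.sqrt (1 - ‖z‖ ^ 2) : ℝ)

theorem defect_mul_self (hz : z ∈ unitBall n) : defect z * defect z = 1 - inner ℂ z z := by
  rw [defect, ← Complex.ofReal_mul, Real.mul_self_sqrt (one_sub_norm_sq_pos hz).le,
    inner_self_eq_norm_sq_to_K]
  push_cast
  rfl

theorem defect_ne_zero (hz : z ∈ unitBall n) : defect z ≠ 0 :=
  Complex.ofReal_ne_zero.2 (Real.sqrt_pos.2 (one_sub_norm_sq_pos hz)).ne'

theorem norm_defect_sq (hz : z ∈ unitBall n) : ‖defect z‖ ^ 2 = 1 - ‖z‖ ^ 2 := by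
  rw [defect, Complex.norm_real, Real.norm_eq_abs, sq_abs,
    Real.sq_sqrt (one_sub_norm_sq_pos hz).le]

theorem moebius_eq (z w : Cn n) :
    moebius z w = (1 - inner ℂ z w)⁻¹ •
      (z - (inner ℂ z w / inner ℂ z z) • z
        - defect z • (w - (inner ℂ z w / inner ℂ z z) • z)) :=
  rfl

theorem inner_div_inner_self_mul (z w : Cn n) :
    inner ℂ z w / inner ℂ z z * (inner ℂ z z : ℂ) = inner ℂ z w :=
  div_mul_cancel_of_imp fun h => by rw [inner_self_eq_zero.1 h, inner_zero_left]

theorem inner_moebius (z w : Cn n) :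
    inner ℂ z (moebius z w) = (1 - inner ℂ z w : ℂ)⁻¹ * (inner ℂ z z - inner ℂ z w) := by
  simp only [moebius, inner_smul_right, inner_sub_right, inner_div_inner_self_mul]
  ring

theorem one_sub_inner_moebius (hz : z ∈ unitBall n) (hw : w ∈ unitBall n) :
    1 - inner ℂ z (moebius z w) = (1 - inner ℂ z z : ℂ) / (1 - inner ℂ z w) := by
  have h := one_sub_inner_ne_zero hz hw
  rw [inner_moebius]
  field_simp
  ring

theorem norm_one_sub_inner_self (hz : z ∈ unitBall n) :
    ‖(1 - inner ℂ z z : ℂ)‖ = 1 - ‖z‖ ^ 2 := by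
  rw [← defect_mul_self hz, norm_mul, ← sq, norm_defect_sq hz]

theorem one_sub_norm_sq_moebius (hz : z ∈ unitBall n) (hw : w ∈ unitBall n) :
    1 - ‖moebius z w‖ ^ 2 = (1 - ‖z‖ ^ 2) * (1 - ‖w‖ ^ 2) / ‖(1 - inner ℂ z w : ℂ)‖ ^ 2 := by
  have h := norm_pos_iff.2 (one_sub_inner_ne_zero hz hw)
  rw [moebius, norm_smul, mul_pow, norm_sq_moebius_aux hz, norm_inv]
  field_simp
  ring

theorem moebius_mem (hz : z ∈ unitBall n) (hw : w ∈ unitBall n) : moebius z w ∈ unitBall n :=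
  mem_unitBall.2 (rho_lt_one hz hw)

theorem moebius_zero_right (z : Cn n) : moebius z 0 = z := by
  simp [moebius]

theorem moebius_moebius (hz : z ∈ unitBall n) (hw : w ∈ unitBall n) :
    moebius z (moebius z w) = w := by
  rcases eq_or_ne z 0 with rfl | hz₀
  · simp [moebius]
  have ha := one_sub_inner_ne_zero hz hw
  have hN : (inner ℂ z z : ℂ) ≠ 0 := inner_self_ne_zero.2 hz₀
  have hN' := one_sub_inner_ne_zero hz hz
  have hs := defect_mul_self hz
  conv_lhs => rw [moebius_eq, one_sub_inner_moebius hz hw, inner_moebius, moebius_eq]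
  generalize (inner ℂ z w : ℂ) = a at *
  generalize (inner ℂ z z : ℂ) = N at *
  match_scalars
  · field_simp
    linear_combination (-a) * hs
  · field_simp
    linear_combination hs

theorem moebius_image (hz : z ∈ unitBall n) : moebius z '' unitBall n = unitBall n :=
  Set.Subset.antisymm (Set.image_subset_iff.2 fun _ hw => moebius_mem hz hw)
    fun w hw => ⟨moebius z w, moebius_mem hz hw, moebius_moebius hz hw⟩

theorem moebius_injOn (hz : z ∈ unitBall n) : Set.InjOn (moebius z) (unitBall n) :=
  Set.LeftInvOn.injOn fun _ => moebius_moebius hz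

/-- The vector `v` for which the derivative of `φ_z` at `w` is a multiple of the transvection
`h ↦ h + ⟨h, z⟩ v`. For `z = 0` its first coefficient is `0 / 0 = 0`, which is harmless because it
multiplies `z`. -/
def shear (z w : Cn n) : Cn n :=
  ((1 - defect z) / (defect z * inner ℂ z z)) • z - (defect z)⁻¹ • moebius z w

/-- The complex derivative of `φ_z` at `w`, as a multiple of a transvection. -/
def moebiusDeriv (z w : Cn n) : Cn n →L[ℂ] Cn n :=
  (-((1 - inner ℂ z w)⁻¹ * defect z)) •
    (ContinuousLinearMap.id ℂ (Cn n) + (innerSL ℂ z).smulRight (shear z w))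

theorem hasFDerivAt_moebius (hz : z ∈ unitBall n) (hw : w ∈ unitBall n) :
    HasFDerivAt (moebius z) (moebiusDeriv z w) w := by
  have ha := one_sub_inner_ne_zero hz hw
  have hs := defect_ne_zero hz
  have h_inner : HasFDerivAt (fun w : Cn n => (inner ℂ z w : ℂ)) (innerSL ℂ z) w :=
    (innerSL ℂ z).hasFDerivAt
  have h_scalar := (hasDerivAt_inv ha).comp_hasFDerivAt w (h_inner.const_sub 1)
  have h_proj : HasFDerivAt (fun w : Cn n => (inner ℂ z w / inner ℂ z z : ℂ) • z)
      (((inner ℂ z z : ℂ)⁻¹ • innerSL ℂ z).smulRight z) w := by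
    simp only [div_eq_inv_mul]
    exact (h_inner.const_mul _).smul_const z
  have h_vector := (h_proj.const_sub z).sub (((hasFDerivAt_id w).sub h_proj).const_smul (defect z))
  refine (h_scalar.smul h_vector).congr_fderiv (ContinuousLinearMap.ext fun h => ?_)
  have hz₀ : defect z = 1 ∨ (inner ℂ z z : ℂ) ≠ 0 := by
    rcases eq_or_ne z 0 with rfl | hz₀
    · exact Or.inl (by simp [defect])
    · exact Or.inr (inner_self_ne_zero.2 hz₀)
  simp only [moebiusDeriv, shear, moebius_eq, Function.comp_apply, add_apply, smul_apply, sub_apply,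
    neg_apply, ContinuousLinearMap.smulRight_apply, ContinuousLinearMap.id_apply,
    innerSL_apply_apply, smul_eq_mul, id_eq, Pi.sub_apply, Pi.smul_apply]
  generalize (inner ℂ z w : ℂ) = a at *
  generalize (inner ℂ z h : ℂ) = b at *
  generalize (inner ℂ z z : ℂ) = N at *
  generalize defect z = s at *
  rcases hz₀ with rfl | hN
  · match_scalars <;> (simp; try field_simp)
  · match_scalars <;> field_simp
    ring

theorem one_add_inner_shear (hz : z ∈ unitBall n) (hw : w ∈ unitBall n) :
    1 + inner ℂ z (shear z w) = defect z / (1 - inner ℂ z w) := by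
  have ha := one_sub_inner_ne_zero hz hw
  have hs := defect_ne_zero hz
  have h_coeff : (1 - defect z) / (defect z * inner ℂ z z) * (inner ℂ z z : ℂ)
      = (1 - defect z) / defect z := by
    rcases eq_or_ne z 0 with rfl | hz₀
    · simp [defect]
    · have := inner_self_ne_zero (𝕜 := ℂ).2 hz₀
      field_simp
  have h_moebius := one_sub_inner_moebius hz hw
  rw [← defect_mul_self hz] at h_moebius
  calc (1 + inner ℂ z (shear z w) : ℂ) = (1 - inner ℂ z (moebius z w)) / defect z := by
        rw [shear, inner_sub_right, inner_smul_right, inner_smul_right, h_coeff]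
        field_simp
        ring
    _ = defect z / (1 - inner ℂ z w) := by
        rw [h_moebius]
        field_simp

theorem det_moebiusDeriv (hz : z ∈ unitBall n) (hw : w ∈ unitBall n) :
    LinearMap.det (moebiusDeriv z w : Cn n →ₗ[ℂ] Cn n)
      = (-1) ^ n * (defect z / (1 - inner ℂ z w)) ^ (n + 1) := by
  have h_transvection : (moebiusDeriv z w : Cn n →ₗ[ℂ] Cn n)
      = (-((1 - inner ℂ z w)⁻¹ * defect z)) •
        LinearMap.transvection (innerSL ℂ z : Cn n →ₗ[ℂ] ℂ) (shear z w) := rfl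
  rw [h_transvection, LinearMap.det_smul, LinearMap.transvection.det, finrank_euclideanSpace_fin,
    ContinuousLinearMap.coe_coe, innerSL_apply_apply, one_add_inner_shear hz hw, neg_pow, pow_succ]
  ring

/-- The modulus of the real Jacobian determinant of `φ_z` at `w`. -/
def jac (z w : Cn n) : ℝ :=
  ((1 - ‖z‖ ^ 2) / ‖(1 - inner ℂ z w : ℂ)‖ ^ 2) ^ (n + 1)

theorem jac_nonneg (hz : z ∈ unitBall n) (w : Cn n) : 0 ≤ jac z w :=
  pow_nonneg (div_nonneg (one_sub_norm_sq_pos hz).le (sq_nonneg _)) _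

theorem abs_det_restrictScalars_moebiusDeriv (hz : z ∈ unitBall n) (hw : w ∈ unitBall n) :
    |((moebiusDeriv z w).restrictScalars ℝ).det| = jac z w := by
  have h_real : ((moebiusDeriv z w).restrictScalars ℝ).det
      = ‖(defect z / (1 - inner ℂ z w)) ^ (n + 1)‖ ^ 2 := by
    change LinearMap.det ((moebiusDeriv z w : Cn n →ₗ[ℂ] Cn n).restrictScalars ℝ) = _
    rw [LinearMap.det_restrictScalars, Algebra.norm_complex_apply, det_moebiusDeriv hz hw,
      Complex.normSq_eq_norm_sq, norm_mul, norm_pow, norm_neg, norm_one, one_pow, one_mul]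
  rw [h_real, abs_of_nonneg (sq_nonneg _), norm_pow, ← pow_mul, mul_comm, pow_mul, norm_div,
    div_pow, norm_defect_sq hz, jac]

theorem hasFDerivWithinAt_moebius (hz : z ∈ unitBall n) (hw : w ∈ unitBall n) :
    HasFDerivWithinAt (moebius z) ((moebiusDeriv z w).restrictScalars ℝ) (unitBall n) w :=
  ((hasFDerivAt_moebius hz hw).restrictScalars ℝ).hasFDerivWithinAt

theorem lintegral_comp_moebius (hz : z ∈ unitBall n) (f : Cn n → ℝ≥0∞) :
    ∫⁻ w, ENNReal.ofReal (jac z w) * f (moebius z w) ∂(vol n) = ∫⁻ w, f w ∂(vol n) := by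
  have h := lintegral_image_eq_lintegral_abs_det_fderiv_mul (volume : Measure (Cn n))
    (measurableSet_unitBall n) (fun _ => hasFDerivWithinAt_moebius hz) (moebius_injOn hz) f
  rw [moebius_image hz] at h
  rw [vol, lintegral_smul_measure, lintegral_smul_measure, h]
  congr 1
  refine setLIntegral_congr_fun (measurableSet_unitBall n) fun w hw => ?_
  simp only [abs_det_restrictScalars_moebiusDeriv hz hw]

theorem integral_comp_moebius (hz : z ∈ unitBall n) (f : Cn n → ℂ) :
    ∫ w, jac z w • f (moebius z w) ∂(vol n) = ∫ w, f w ∂(vol n) := by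
  have h := integral_image_eq_integral_abs_det_fderiv_smul (volume : Measure (Cn n))
    (measurableSet_unitBall n) (fun _ => hasFDerivWithinAt_moebius hz) (moebius_injOn hz) f
  rw [moebius_image hz] at h
  rw [vol, integral_smul_measure, integral_smul_measure, h]
  congr 1
  refine setIntegral_congr_fun (measurableSet_unitBall n) fun w hw => ?_
  simp only [abs_det_restrictScalars_moebiusDeriv hz hw]

theorem integrable_vol_iff {f : Cn n → ℂ} :
    Integrable f (vol n) ↔ IntegrableOn f (unitBall n) volume :=
  integrable_smul_measure (ENNReal.inv_ne_zero.2 measure_ball_lt_top.ne)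
    (ENNReal.inv_ne_top.2 (volume_unitBall_ne_zero n))

theorem integrable_comp_moebius (hz : z ∈ unitBall n) {f : Cn n → ℂ} (hf : Integrable f (vol n)) :
    Integrable (fun w => jac z w • f (moebius z w)) (vol n) := by
  have h := integrableOn_image_iff_integrableOn_abs_det_fderiv_smul (volume : Measure (Cn n))
    (measurableSet_unitBall n) (fun _ => hasFDerivWithinAt_moebius hz) (moebius_injOn hz) f
  rw [moebius_image hz] at h
  rw [integrable_vol_iff] at hf ⊢
  refine (h.1 hf).congr_fun (fun w hw => ?_) (measurableSet_unitBall n)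
  simp only [abs_det_restrictScalars_moebiusDeriv hz hw]

end Moebius

/-! ### The reproducing property -/

section Reproducing

variable {n : ℕ} {z w : Cn n} {f : Cn n → ℂ}

instance instIsProbabilityMeasureVol (n : ℕ) : IsProbabilityMeasure (vol n) := by
  constructor
  rw [vol, Measure.smul_apply, Measure.restrict_apply_univ, smul_eq_mul]
  exact ENNReal.inv_mul_cancel (volume_unitBall_ne_zero n) measure_ball_lt_top.ne

theorem aestronglyMeasurable_vol_of_continuousOn {E : Type*} [TopologicalSpace E]
    [TopologicalSpace.PseudoMetrizableSpace E] {f : Cn n → E} (hf : ContinuousOn f (unitBall n)) :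
    AEStronglyMeasurable f (vol n) :=
  (hf.aestronglyMeasurable (measurableSet_unitBall n)).smul_measure _

theorem measurePreserving_smul_vol {c : ℂ} (hc : ‖c‖ = 1) :
    MeasurePreserving (fun w : Cn n => c • w) (vol n) (vol n) := by
  have hc₀ : c ≠ 0 := norm_ne_zero_iff.1 (hc ▸ one_ne_zero)
  let U : Cn n ≃ₗᵢ[ℝ] Cn n :=
    { toLinearEquiv := (LinearEquiv.smulOfNeZero ℂ (Cn n) c hc₀).restrictScalars ℝ
      norm_map' := fun w => (norm_smul c w).trans (by rw [hc, one_mul]) }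
  have h_preimage : U ⁻¹' unitBall n = unitBall n := by
    ext w
    simp [mem_unitBall]
  have h := U.measurePreserving.restrict_preimage (measurableSet_unitBall n)
  rw [h_preimage] at h
  exact h.smul_measure _

theorem integrable_circleMap_smul (hf : Integrable f (vol n)) :
    Integrable (Function.uncurry fun (θ : ℝ) (w : Cn n) => f (circleMap 0 1 θ • w))
      ((volume.restrict (Set.uIoc 0 (2 * Real.pi))).prod (vol n)) := by
  have h_skew : MeasurePreserving (fun q : ℝ × Cn n => (q.1, circleMap 0 1 q.1 • q.2))
      ((volume.restrict (Set.uIoc 0 (2 * Real.pi))).prod (vol n))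
      ((volume.restrict (Set.uIoc 0 (2 * Real.pi))).prod (vol n)) :=
    (MeasurePreserving.id _).skew_product (g := fun θ w => circleMap 0 1 θ • w)
      (Continuous.measurable (by fun_prop))
      (Eventually.of_forall fun θ => (measurePreserving_smul_vol (by simp)).map_eq)
  have : IsFiniteMeasure ((volume : Measure ℝ).restrict (Set.uIoc 0 (2 * Real.pi))) :=
    ⟨by rw [Measure.restrict_apply_univ, Set.uIoc]; exact measure_Ioc_lt_top⟩
  exact h_skew.integrable_comp_of_integrable (hf.comp_snd _)

theorem integral_comp_circleMap_smul (hf : Integrable f (vol n)) (θ : ℝ) :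
    ∫ w, f (circleMap 0 1 θ • w) ∂(vol n) = ∫ w, f w ∂(vol n) := by
  have h_rot : MeasurePreserving (fun w : Cn n => circleMap 0 1 θ • w) (vol n) (vol n) :=
    measurePreserving_smul_vol (by simp)
  rw [← integral_map (f := f) h_rot.aemeasurable
    (h_rot.map_eq.symm ▸ hf.aestronglyMeasurable), h_rot.map_eq]

theorem integral_integral_circleMap_smul (hf : Integrable f (vol n)) :
    ∫ w, (∫ θ in (0 : ℝ)..2 * Real.pi, f (circleMap 0 1 θ • w)) ∂(vol n)
      = 2 * Real.pi * ∫ w, f w ∂(vol n) := by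
  rw [← intervalIntegral_integral_swap (integrable_circleMap_smul hf)]
  simp only [integral_comp_circleMap_smul hf, intervalIntegral.integral_const, sub_zero,
    Complex.real_smul]
  push_cast
  rfl

theorem integral_circleMap_smul (hf : DifferentiableOn ℂ f (unitBall n)) (hw : w ∈ unitBall n) :
    ∫ θ in (0 : ℝ)..2 * Real.pi, f (circleMap 0 1 θ • w) = 2 * Real.pi * f 0 := by
  have h_maps : Set.MapsTo (fun ζ : ℂ => ζ • w) (Metric.closedBall 0 1) (unitBall n) := by
    intro ζ hζ
    rw [mem_unitBall] at hw ⊢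
    rw [mem_closedBall_zero_iff] at hζ
    exact (norm_smul ζ w).trans_lt ((mul_le_of_le_one_left (norm_nonneg w) hζ).trans_lt hw)
  have h_disc : DifferentiableOn ℂ (fun ζ : ℂ => f (ζ • w)) (closure (Metric.ball 0 |1|)) := by
    rw [abs_one, closure_ball (0 : ℂ) one_ne_zero]
    exact hf.comp (by fun_prop) h_maps
  have h_mean := h_disc.diffContOnCl.circleAverage
  rw [Real.circleAverage_def, zero_smul] at h_mean
  rw [← h_mean, Complex.real_smul]
  push_cast
  rw [mul_inv_cancel_left₀ (by simp [Real.pi_ne_zero])]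

theorem integral_vol_eq_apply_zero (hf : DifferentiableOn ℂ f (unitBall n))
    (hi : Integrable f (vol n)) : ∫ w, f w ∂(vol n) = f 0 := by
  have h_mean : ∀ᵐ w ∂(vol n),
      ∫ θ in (0 : ℝ)..2 * Real.pi, f (circleMap 0 1 θ • w) = 2 * Real.pi * f 0 := by
    filter_upwards [ae_mem_unitBall n] with w hw using integral_circleMap_smul hf hw
  have h := integral_integral_circleMap_smul hi
  rw [integral_congr_ae h_mean, integral_const, probReal_univ, one_smul] at h
  exact (mul_left_cancel₀ (by simp [Real.pi_ne_zero]) h).symm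

theorem K_eq_inv_smul_k (hz : z ∈ unitBall n) :
    K z = (((1 - ‖z‖ ^ 2) ^ (((n : ℝ) + 1) / 2) : ℝ) : ℂ)⁻¹ • k z := by
  ext w
  have h := Real.rpow_pos_of_pos (one_sub_norm_sq_pos hz) (((n : ℝ) + 1) / 2)
  rw [Pi.smul_apply, smul_eq_mul, k, inv_mul_cancel_left₀ (Complex.ofReal_ne_zero.2 h.ne')]

theorem differentiableOn_K (hz : z ∈ unitBall n) : DifferentiableOn ℂ (K z) (unitBall n) := by
  rw [K_eq_inv_smul_k hz]
  exact (differentiableOn_k hz).const_smul _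

theorem memLp_K (p : ℝ≥0∞) (hz : z ∈ unitBall n) : MemLp (K z) p (vol n) := by
  rw [K_eq_inv_smul_k hz]
  exact (memLp_k p hz).const_smul _

theorem integrable_K (hz : z ∈ unitBall n) : Integrable (K z) (vol n) :=
  memLp_one_iff_integrable.1 (memLp_K 1 hz)

theorem conj_K (z w : Cn n) : (starRingEnd ℂ) (K z w) = K w z := by
  simp [K, inner_conj_symm]

theorem norm_K_comm (z w : Cn n) : ‖K z w‖ = ‖K w z‖ := by
  rw [← conj_K, RCLike.norm_conj]

theorem K_zero_right (z : Cn n) : K z 0 = 1 := by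
  simp [K]

/-- The Bergman projection on functions: the integral operator with kernel `K_w(z)`. -/
def projFun (f : Cn n → ℂ) (z : Cn n) : ℂ :=
  ∫ w, K w z * f w ∂(vol n)

theorem integrable_K_mul (hf : Integrable f (vol n)) (hz : z ∈ unitBall n) :
    Integrable (fun w => K w z * f w) (vol n) := by
  refine (hf.mul_of_top_right (memLp_K ⊤ hz).star).congr (Eventually.of_forall fun w => ?_)
  simp only [Pi.mul_apply, Pi.star_apply, RCLike.star_def, conj_K]

theorem jac_mul_K_moebius (hz : z ∈ unitBall n) (hw : w ∈ unitBall n) :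
    (jac z w : ℂ) * K (moebius z w) z = K z w := by
  have ha := one_sub_inner_ne_zero hz hw
  have ha' : (starRingEnd ℂ) (1 - inner ℂ z w) ≠ 0 := (map_ne_zero _).2 ha
  have hN := one_sub_inner_ne_zero hz hz
  have h_self : ((1 - ‖z‖ ^ 2 : ℝ) : ℂ) = 1 - inner ℂ z z := by
    rw [← norm_defect_sq hz, ← defect_mul_self hz, defect, Complex.norm_real, Real.norm_eq_abs,
      sq_abs, sq, Complex.ofReal_mul]
  have h_norm : ((‖(1 - inner ℂ z w : ℂ)‖ ^ 2 : ℝ) : ℂ)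
      = (1 - inner ℂ z w) * (starRingEnd ℂ) (1 - inner ℂ z w) := by
    rw [Complex.mul_conj, Complex.normSq_eq_norm_sq]
  have h_inner : (1 - inner ℂ (moebius z w) z : ℂ)
      = (1 - inner ℂ z z) / (starRingEnd ℂ) (1 - inner ℂ z w) := by
    rw [← inner_conj_symm, ← map_one (starRingEnd ℂ), ← map_sub, one_sub_inner_moebius hz hw,
      map_div₀, map_sub, map_one, inner_conj_symm]
  rw [K, K, h_inner, jac, Complex.ofReal_pow, Complex.ofReal_div, h_norm, h_self, ← inv_pow,
    ← inv_pow, ← mul_pow]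
  congr 1
  field_simp

theorem projFun_eq_of_differentiableOn (hf : DifferentiableOn ℂ f (unitBall n))
    (hi : Integrable f (vol n)) (hz : z ∈ unitBall n) : projFun f z = f z := by
  have h_jac : (fun w => jac z w • (K (moebius z w) z * f (moebius z w))) =ᵐ[vol n]
      fun w => K z w * f (moebius z w) := by
    filter_upwards [ae_mem_unitBall n] with w hw
    rw [Complex.real_smul, ← mul_assoc, jac_mul_K_moebius hz hw]
  have h_integrable := (integrable_comp_moebius hz (integrable_K_mul hi hz)).congr h_jac
  have h_diff : DifferentiableOn ℂ (fun w => K z w * f (moebius z w)) (unitBall n) :=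
    (differentiableOn_K hz).mul (hf.comp
      (fun w hw => (hasFDerivAt_moebius hz hw).differentiableAt.differentiableWithinAt)
      fun w hw => moebius_mem hz hw)
  rw [projFun, ← integral_comp_moebius hz, integral_congr_ae h_jac,
    integral_vol_eq_apply_zero h_diff h_integrable, moebius_zero_right, K_zero_right, one_mul]

theorem norm_K_self (hz : z ∈ unitBall n) : ‖K z z‖ = ((1 - ‖z‖ ^ 2) ^ (n + 1))⁻¹ := by
  rw [K, norm_inv, norm_pow, norm_one_sub_inner_self hz]

theorem lintegral_enorm_K_sq (hz : z ∈ unitBall n) :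
    ∫⁻ w, ‖K z w‖ₑ ^ 2 ∂(vol n) = ENNReal.ofReal (((1 - ‖z‖ ^ 2) ^ (n + 1))⁻¹) := by
  have h_norm_sq : ∀ w, K w z * K z w = ((‖K z w‖ ^ 2 : ℝ) : ℂ) := fun w => by
    rw [← conj_K z w, mul_comm, Complex.mul_conj, Complex.normSq_eq_norm_sq]
  have h := projFun_eq_of_differentiableOn (differentiableOn_K hz) (integrable_K hz) hz
  simp only [projFun, h_norm_sq, integral_complex_ofReal] at h
  rw [← norm_K_self hz, ← h, Complex.norm_real, Real.norm_of_nonneg (by positivity),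
    ofReal_integral_eq_lintegral_ofReal (memLp_K 2 hz).integrable_norm_pow'
    (Eventually.of_forall fun w => by positivity)]
  simp only [ENNReal.ofReal_pow (norm_nonneg _), ofReal_norm]

theorem normK_eq (hz : z ∈ unitBall n) :
    normK z = (1 - ‖z‖ ^ 2) ^ (-(((n : ℝ) + 1) / 2)) := by
  have hs := one_sub_norm_sq_pos hz
  have h := eLpNorm_eq_lintegral_rpow_enorm_toReal (f := K z) (μ := vol n) (p := 2) (by simp)
    (by simp)
  simp only [ENNReal.toReal_ofNat, ENNReal.rpow_ofNat] at h
  rw [normK, h, lintegral_enorm_K_sq hz, ENNReal.ofReal_rpow_of_pos (by positivity),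
    ENNReal.toReal_ofReal (by positivity), Real.rpow_neg hs.le, Real.inv_rpow (by positivity),
    ← Real.rpow_natCast, ← Real.rpow_mul hs.le]
  push_cast
  ring_nf

end Reproducing

/-! ### The Forelli–Rudin estimate -/

section ForelliRudin

variable {n : ℕ} {z w : Cn n} {t : ℝ}

theorem integrableOn_one_sub_sq_rpow (ht₀ : 0 ≤ t) (ht : t < 1) :
    IntegrableOn (fun y : ℝ => (1 - y ^ 2) ^ (-t)) (Set.Ioo 0 1) := by
  have h_linear : IntegrableOn (fun y : ℝ => (1 - y) ^ (-t)) (Set.Ioo 0 1) := by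
    have h := intervalIntegral.intervalIntegrable_rpow' (a := 0) (b := 1) (neg_lt_neg ht)
    have h_reflected := (h.comp_sub_left 1).symm
    simp only [sub_zero, sub_self] at h_reflected
    rwa [intervalIntegrable_iff_integrableOn_Ioo_of_le zero_le_one] at h_reflected
  refine Integrable.mono' h_linear (Measurable.aestronglyMeasurable (by fun_prop)) ?_
  filter_upwards [ae_restrict_mem measurableSet_Ioo] with y hy
  have hy_pos : 0 < 1 - y := sub_pos.2 hy.2
  have hy_le : 1 - y ≤ 1 - y ^ 2 := by nlinarith [hy.1, hy.2]
  rw [Real.norm_of_nonneg (Real.rpow_nonneg (hy_pos.le.trans hy_le) _)]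
  exact Real.rpow_le_rpow_of_nonpos hy_pos hy_le (neg_nonpos.2 ht₀)

theorem lintegral_one_sub_norm_sq_rpow_lt_top (n : ℕ) (ht₀ : 0 ≤ t) (ht : t < 1) :
    ∫⁻ w, ENNReal.ofReal ((1 - ‖w‖ ^ 2) ^ (-t)) ∂(vol n) < ⊤ := by
  cases subsingleton_or_nontrivial (Cn n) with
  | inl _ => simp [Subsingleton.elim _ (0 : Cn n)]
  | inr _ =>
    have h_radial : IntegrableOn (fun y : ℝ => y ^ (Module.finrank ℝ (Cn n) - 1) *
        (1 - y ^ 2) ^ (-t)) (Set.Ioo 0 1) := by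
      refine (integrableOn_one_sub_sq_rpow ht₀ ht).bdd_mul (c := 1) (by fun_prop) ?_
      filter_upwards [ae_restrict_mem measurableSet_Ioo] with y hy
      rw [norm_pow, Real.norm_of_nonneg hy.1.le]
      exact pow_le_one₀ hy.1.le hy.2.le
    have h_ball : IntegrableOn (fun w : Cn n => (1 - ‖w‖ ^ 2) ^ (-t)) (unitBall n) :=
      (integrableOn_fun_norm_addHaar (f := fun y : ℝ => (1 - y ^ 2) ^ (-t)) volume).2 h_radial
    rw [vol, lintegral_smul_measure]
    exact ENNReal.mul_lt_top (ENNReal.inv_lt_top.2 (volume_unitBall_ne_zero n).bot_lt)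
      ((lintegral_mono fun w => Real.ofReal_le_enorm _).trans_lt h_ball.2)

/-- The Forelli–Rudin integral `∫ (1 - |w|²)⁻ᵗ |1 - ⟨w, z⟩|⁻ᵅ dv(w)`. -/
def forelliRudin (t : ℝ) (α : ℕ) (z : Cn n) : ℝ≥0∞ :=
  ∫⁻ w, ENNReal.ofReal ((1 - ‖w‖ ^ 2) ^ (-t)) *
    ENNReal.ofReal ((‖(1 - inner ℂ z w : ℂ)‖ ^ α)⁻¹) ∂(vol n)

theorem forelliRudin_zero (z : Cn n) :
    forelliRudin t 0 z = ∫⁻ w, ENNReal.ofReal ((1 - ‖w‖ ^ 2) ^ (-t)) ∂(vol n) := by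
  simp [forelliRudin]

theorem norm_one_sub_inner_le_two (hz : z ∈ unitBall n) (hw : w ∈ unitBall n) :
    ‖(1 - inner ℂ z w : ℂ)‖ ≤ 2 := by
  have h := norm_sub_le (1 : ℂ) (inner ℂ z w)
  rw [norm_one] at h
  linarith [norm_inner_lt_one hz hw]

theorem one_sub_norm_pos (hz : z ∈ unitBall n) : 0 < 1 - ‖z‖ :=
  sub_pos.2 (mem_unitBall.1 hz)

theorem one_sub_norm_le_one_sub_norm_sq (hz : z ∈ unitBall n) : 1 - ‖z‖ ≤ 1 - ‖z‖ ^ 2 := by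
  nlinarith [norm_nonneg z, one_sub_norm_pos hz]

theorem jac_mul_weight_moebius_eq (t : ℝ) (hz : z ∈ unitBall n) (hw : w ∈ unitBall n) :
    jac z w * ((1 - ‖moebius z w‖ ^ 2) ^ (-t) *
        (‖(1 - inner ℂ z (moebius z w) : ℂ)‖ ^ (n + 1 + (n + 1)))⁻¹)
      = ‖(1 - inner ℂ z w : ℂ)‖ ^ (2 * t) * (1 - ‖z‖ ^ 2) ^ (-((n + 1 : ℕ) + t)) *
        (1 - ‖w‖ ^ 2) ^ (-t) := by
  have hb := norm_pos_iff.2 (one_sub_inner_ne_zero hz hw)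
  have hs := one_sub_norm_sq_pos hz
  have hv := one_sub_norm_sq_pos hw
  rw [one_sub_norm_sq_moebius hz hw, one_sub_inner_moebius hz hw, jac, norm_div,
    norm_one_sub_inner_self hz]
  generalize ‖(1 - inner ℂ z w : ℂ)‖ = b at *
  generalize 1 - ‖w‖ ^ 2 = v at *
  generalize 1 - ‖z‖ ^ 2 = s at *
  have h_weight : (s * v / b ^ 2) ^ (-t) = s ^ (-t) * v ^ (-t) * b ^ (2 * t) := by
    rw [Real.div_rpow (by positivity) (by positivity), Real.mul_rpow hs.le hv.le,
      Real.rpow_neg (sq_nonneg b), ← Real.rpow_natCast, ← Real.rpow_mul hb.le, div_inv_eq_mul,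
      Nat.cast_ofNat]
  have h_exponent : s ^ (-((n + 1 : ℕ) + t)) = (s ^ (n + 1))⁻¹ * s ^ (-t) := by
    rw [neg_add, Real.rpow_add hs, Real.rpow_neg hs.le, Real.rpow_natCast]
  have h_jac : (s / b ^ 2) ^ (n + 1) * ((s / b) ^ (n + 1 + (n + 1)))⁻¹ = (s ^ (n + 1))⁻¹ := by
    rw [← two_mul, div_pow s (b ^ 2), div_pow s b, ← pow_mul]
    field_simp
    ring
  rw [h_weight, h_exponent, ← h_jac]
  ring

theorem jac_mul_weight_moebius_le (ht₀ : 0 ≤ t) (ht : t ≤ 1) (hz : z ∈ unitBall n)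
    (hw : w ∈ unitBall n) :
    jac z w * ((1 - ‖moebius z w‖ ^ 2) ^ (-t) *
        (‖(1 - inner ℂ z (moebius z w) : ℂ)‖ ^ (n + 1 + (n + 1)))⁻¹)
      ≤ 4 * (1 - ‖z‖) ^ (-((n + 1 : ℕ) + t)) * (1 - ‖w‖ ^ 2) ^ (-t) := by
  have hv := one_sub_norm_sq_pos hw
  have h_four : ‖(1 - inner ℂ z w : ℂ)‖ ^ (2 * t) ≤ 4 := by
    calc ‖(1 - inner ℂ z w : ℂ)‖ ^ (2 * t) ≤ 2 ^ (2 * t) :=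
          Real.rpow_le_rpow (norm_nonneg _) (norm_one_sub_inner_le_two hz hw) (by linarith)
      _ ≤ 2 ^ (2 : ℝ) := Real.rpow_le_rpow_of_exponent_le (by norm_num) (by linarith)
      _ = 4 := by norm_num
  have h_weight : (1 - ‖z‖ ^ 2) ^ (-((n + 1 : ℕ) + t)) ≤ (1 - ‖z‖) ^ (-((n + 1 : ℕ) + t)) :=
    Real.rpow_le_rpow_of_nonpos (one_sub_norm_pos hz) (one_sub_norm_le_one_sub_norm_sq hz)
      (neg_nonpos.2 (by positivity))
  have hs := one_sub_norm_sq_pos hz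
  rw [jac_mul_weight_moebius_eq t hz hw]
  gcongr

theorem forelliRudin_top_le (ht₀ : 0 ≤ t) (ht : t ≤ 1) (hz : z ∈ unitBall n) :
    forelliRudin t (n + 1 + (n + 1)) z ≤ 4 * forelliRudin t 0 (0 : Cn n) *
      ENNReal.ofReal ((1 - ‖z‖) ^ (-((n + 1 : ℕ) + t))) := by
  have hs := one_sub_norm_pos hz
  rw [forelliRudin, ← lintegral_comp_moebius hz, forelliRudin_zero, mul_comm, ← mul_assoc,
    ← lintegral_const_mul _ (by fun_prop)]
  refine lintegral_mono_ae ?_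
  filter_upwards [ae_mem_unitBall n] with w hw
  rw [← ENNReal.ofReal_mul (Real.rpow_nonneg (one_sub_norm_sq_pos (moebius_mem hz hw)).le _),
    ← ENNReal.ofReal_mul (jac_nonneg hz w), ← ENNReal.ofReal_ofNat 4,
    ← ENNReal.ofReal_mul (by positivity), ← ENNReal.ofReal_mul (by positivity),
    mul_comm _ (4 : ℝ)]
  exact ENNReal.ofReal_le_ofReal (jac_mul_weight_moebius_le ht₀ ht hz hw)

theorem inv_one_sub_pow_eq {a : ℂ} (ha : ‖a‖ < 1) (α : ℕ) :
    ((1 - a) ^ α)⁻¹ = 1 + ∫ x in (0 : ℝ)..1, α * a * ((1 - x * a) ^ (α + 1))⁻¹ := by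
  have h_ne : ∀ x ∈ Set.uIcc (0 : ℝ) 1, (1 - x * a : ℂ) ≠ 0 := by
    intro x hx h
    rw [Set.uIcc_of_le zero_le_one] at hx
    have h_lt : ‖(x * a : ℂ)‖ < 1 := by
      rw [norm_mul, Complex.norm_real, Real.norm_of_nonneg hx.1]
      exact (mul_le_of_le_one_left (norm_nonneg a) hx.2).trans_lt ha
    rw [← sub_eq_zero.1 h, norm_one] at h_lt
    exact lt_irrefl _ h_lt
  have h_deriv : ∀ x ∈ Set.uIcc (0 : ℝ) 1,
      HasDerivAt (fun x : ℝ => ((1 - x * a : ℂ) ^ α)⁻¹) (α * a * ((1 - x * a) ^ (α + 1))⁻¹) x := by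
    intro x hx
    have h_ne_x := h_ne x hx
    have h_linear : HasDerivAt (fun x : ℝ => (1 - x * a : ℂ)) (-(1 * a)) x :=
      (Complex.ofRealCLM.hasDerivAt.mul_const a).const_sub 1
    refine ((h_linear.pow α).inv (pow_ne_zero _ h_ne_x)).congr_deriv ?_
    rcases α with _ | m
    · simp
    · simp only [Pi.pow_apply, Nat.add_sub_cancel]
      field_simp
      ring
  have h_integrable : IntervalIntegrable (fun x : ℝ => α * a * ((1 - x * a) ^ (α + 1))⁻¹)
      volume 0 1 :=
    (continuousOn_const.mul (ContinuousOn.inv₀ (by fun_prop)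
      fun x hx => pow_ne_zero _ (h_ne x hx))).intervalIntegrable
  rw [intervalIntegral.integral_eq_sub_of_hasDerivAt h_deriv h_integrable]
  simp

theorem ofReal_inv_norm_one_sub_pow_le {a : ℂ} (ha : ‖a‖ < 1) (α : ℕ) :
    ENNReal.ofReal ((‖1 - a‖ ^ α)⁻¹) ≤ 1 + ∫⁻ x in Set.Ioc (0 : ℝ) 1,
      ENNReal.ofReal (α * ‖a‖ * (‖1 - x * a‖ ^ (α + 1))⁻¹) := by
  rw [← norm_pow, ← norm_inv, ofReal_norm, inv_one_sub_pow_eq ha,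
    intervalIntegral.integral_of_le zero_le_one]
  refine (enorm_add_le _ _).trans (add_le_add enorm_one.le ?_)
  refine (enorm_integral_le_lintegral_enorm _).trans_eq (lintegral_congr fun x => ?_)
  rw [← ofReal_norm, norm_mul, norm_mul, norm_inv, norm_pow, Complex.norm_natCast]

theorem forelliRudin_le_add_lintegral (t : ℝ) (α : ℕ) (hz : z ∈ unitBall n) :
    forelliRudin t α z ≤ forelliRudin t 0 (0 : Cn n) + ∫⁻ x in Set.Ioc (0 : ℝ) 1,
      ENNReal.ofReal (α * ‖z‖) * forelliRudin t (α + 1) ((x : ℂ) • z) := by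
  set W : Cn n → ℝ≥0∞ := fun w => ENNReal.ofReal ((1 - ‖w‖ ^ 2) ^ (-t))
  have hW : Measurable W := by fun_prop
  calc forelliRudin t α z
      ≤ ∫⁻ w, (W w + ∫⁻ x in Set.Ioc (0 : ℝ) 1, W w * ENNReal.ofReal
          (α * ‖z‖ * (‖(1 - inner ℂ ((x : ℂ) • z) w : ℂ)‖ ^ (α + 1))⁻¹)) ∂(vol n) := by
        refine lintegral_mono_ae ?_
        filter_upwards [ae_mem_unitBall n] with w hw
        have h_inner : ‖(inner ℂ z w : ℂ)‖ ≤ ‖z‖ := (norm_inner_le_norm z w).trans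
          (mul_le_of_le_one_right (norm_nonneg z) (mem_unitBall.1 hw).le)
        rw [lintegral_const_mul _ (by fun_prop)]
        refine (mul_le_mul_right (ofReal_inv_norm_one_sub_pow_le (norm_inner_lt_one hz hw) α)
          _).trans ?_
        rw [mul_add, mul_one]
        simp only [inner_smul_left, Complex.conj_ofReal]
        gcongr
    _ = forelliRudin t 0 (0 : Cn n) + ∫⁻ x in Set.Ioc (0 : ℝ) 1,
          ENNReal.ofReal (α * ‖z‖) * forelliRudin t (α + 1) ((x : ℂ) • z) := by
        rw [lintegral_add_left hW, forelliRudin_zero, lintegral_lintegral_swap]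
        · congr 1
          refine lintegral_congr fun x => ?_
          rw [forelliRudin, ← lintegral_const_mul _ (by fun_prop)]
          refine lintegral_congr fun w => ?_
          rw [ENNReal.ofReal_mul (by positivity), mul_left_comm]
        · exact Measurable.aemeasurable (by simp only [Function.uncurry_def]; fun_prop)

theorem lintegral_mul_one_sub_mul_rpow_le {r e : ℝ} (hr₀ : 0 ≤ r) (hr : r < 1) (he : 1 < e) :
    ∫⁻ x in Set.Ioc (0 : ℝ) 1, ENNReal.ofReal (r * (1 - r * x) ^ (-e))
      ≤ ENNReal.ofReal ((e - 1)⁻¹ * (1 - r) ^ (-(e - 1))) := by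
  have h_pos : ∀ x ∈ Set.Icc (0 : ℝ) 1, 0 < 1 - r * x := fun x hx => by nlinarith [hx.1, hx.2]
  have h_integrable : IntervalIntegrable (fun x : ℝ => r * (1 - r * x) ^ (-e)) volume 0 1 := by
    refine (continuousOn_const.mul (ContinuousOn.rpow_const (by fun_prop)
      fun x hx => Or.inl (h_pos x ?_).ne')).intervalIntegrable
    rwa [Set.uIcc_of_le zero_le_one] at hx
  have h_integral : ∫ x in (0 : ℝ)..1, r * (1 - r * x) ^ (-e)
      = (e - 1)⁻¹ * ((1 - r) ^ (-(e - 1)) - 1) := by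
    have h_notMem : (0 : ℝ) ∉ Set.uIcc (1 - r) 1 := fun h => by
      rw [Set.uIcc_of_le (by linarith)] at h
      linarith [h.1]
    rw [intervalIntegral.integral_const_mul,
      intervalIntegral.mul_integral_comp_sub_mul (f := fun y : ℝ => y ^ (-e)) r 1, mul_one,
      mul_zero, sub_zero, integral_rpow (Or.inr ⟨by linarith, h_notMem⟩), Real.one_rpow,
      neg_add_eq_sub, neg_sub, ← neg_sub e 1, div_neg, ← neg_div, neg_sub, div_eq_inv_mul]
  rw [intervalIntegral.integral_of_le zero_le_one] at h_integral
  rw [intervalIntegrable_iff_integrableOn_Ioc_of_le zero_le_one] at h_integrable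
  rw [← ofReal_integral_eq_lintegral_ofReal h_integrable, h_integral]
  · exact ENNReal.ofReal_le_ofReal (mul_le_mul_of_nonneg_left (by linarith)
      (inv_nonneg.2 (by linarith)))
  · filter_upwards [ae_restrict_mem measurableSet_Ioc] with x hx
    exact mul_nonneg hr₀ (Real.rpow_nonneg (h_pos x (Set.Ioc_subset_Icc_self hx)).le _)

theorem forelliRudin_le_of_succ {e : ℝ} {α : ℕ} {C : ℝ≥0∞} (he : 1 < e)
    (hC : ∀ z : Cn n, z ∈ unitBall n →
      forelliRudin t (α + 1) z ≤ C * ENNReal.ofReal ((1 - ‖z‖) ^ (-e)))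
    (hz : z ∈ unitBall n) :
    forelliRudin t α z ≤ (forelliRudin t 0 (0 : Cn n) + α * C * ENNReal.ofReal (e - 1)⁻¹) *
      ENNReal.ofReal ((1 - ‖z‖) ^ (-(e - 1))) := by
  have hs := one_sub_norm_pos hz
  have h_norm : ∀ x ∈ Set.Ioc (0 : ℝ) 1, ‖(x : ℂ) • z‖ = ‖z‖ * x := fun x hx => by
    rw [norm_smul, Complex.norm_real, Real.norm_of_nonneg hx.1.le, mul_comm]
  have h_one : 1 ≤ ENNReal.ofReal ((1 - ‖z‖) ^ (-(e - 1))) := ENNReal.one_le_ofReal.2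
    (Real.one_le_rpow_of_pos_of_le_one_of_nonpos hs (by linarith [norm_nonneg z]) (by linarith))
  calc forelliRudin t α z
      ≤ forelliRudin t 0 (0 : Cn n) + ∫⁻ x in Set.Ioc (0 : ℝ) 1,
          ENNReal.ofReal (α * ‖z‖) * forelliRudin t (α + 1) ((x : ℂ) • z) :=
        forelliRudin_le_add_lintegral t α hz
    _ ≤ forelliRudin t 0 (0 : Cn n) + ∫⁻ x in Set.Ioc (0 : ℝ) 1,
          α * C * ENNReal.ofReal (‖z‖ * (1 - ‖z‖ * x) ^ (-e)) := by
        refine add_le_add le_rfl (setLIntegral_mono' measurableSet_Ioc fun x hx => ?_)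
        have hxz : (x : ℂ) • z ∈ unitBall n := by
          rw [mem_unitBall, h_norm x hx]
          exact (mul_le_of_le_one_right (norm_nonneg z) hx.2).trans_lt (mem_unitBall.1 hz)
        refine (mul_le_mul_right (hC _ hxz) _).trans_eq ?_
        rw [h_norm x hx, ENNReal.ofReal_mul (by positivity), ENNReal.ofReal_mul (norm_nonneg z),
          ENNReal.ofReal_natCast]
        ring
    _ ≤ forelliRudin t 0 (0 : Cn n) * ENNReal.ofReal ((1 - ‖z‖) ^ (-(e - 1))) +
          α * C * (ENNReal.ofReal (e - 1)⁻¹ * ENNReal.ofReal ((1 - ‖z‖) ^ (-(e - 1)))) := by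
        rw [lintegral_const_mul _ (by fun_prop),
          ← ENNReal.ofReal_mul (inv_nonneg.2 (by linarith))]
        gcongr
        · exact le_mul_of_one_le_right' h_one
        · exact lintegral_mul_one_sub_mul_rpow_le (norm_nonneg z) (mem_unitBall.1 hz) he
    _ = _ := by ring

theorem exists_forelliRudin_le (n : ℕ) (ht₀ : 0 < t) (ht : t < 1) {i : ℕ} (hi : i ≤ n + 1) :
    ∃ C : ℝ≥0∞, C < ⊤ ∧ ∀ z : Cn n, z ∈ unitBall n →
      forelliRudin t (n + 1 + i) z ≤ C * ENNReal.ofReal ((1 - ‖z‖) ^ (-(i + t))) := by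
  have h₀ : forelliRudin t 0 (0 : Cn n) < ⊤ := by
    rw [forelliRudin_zero]
    exact lintegral_one_sub_norm_sq_rpow_lt_top n ht₀.le ht
  induction hi using Nat.decreasingInduction with
  | self =>
    exact ⟨_, ENNReal.mul_lt_top (by simp) h₀, fun z hz => forelliRudin_top_le ht₀.le ht.le hz⟩
  | of_succ i _ ih =>
    obtain ⟨C, hC, h⟩ := ih
    have he : (1 : ℝ) < (i + 1 : ℕ) + t := by
      push_cast
      linarith [(Nat.cast_nonneg i : (0 : ℝ) ≤ i)]
    refine ⟨forelliRudin t 0 (0 : Cn n) + (n + 1 + i : ℕ) * C *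
      ENNReal.ofReal ((i + 1 : ℕ) + t - 1)⁻¹, ENNReal.add_lt_top.2 ⟨h₀, ENNReal.mul_lt_top
      (ENNReal.mul_lt_top (ENNReal.natCast_lt_top _) hC) ENNReal.ofReal_lt_top⟩,
      fun z hz => (forelliRudin_le_of_succ he h hz).trans_eq ?_⟩
    rw [show ((i + 1 : ℕ) : ℝ) + t - 1 = i + t by push_cast; ring]
    rfl

theorem exists_lintegral_K_le (n : ℕ) (ht₀ : 0 < t) (ht : t < 1) :
    ∃ C : ℝ≥0∞, C < ⊤ ∧ ∀ z : Cn n, z ∈ unitBall n →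
      ∫⁻ w, ‖K w z‖ₑ * ENNReal.ofReal ((1 - ‖w‖ ^ 2) ^ (-t)) ∂(vol n)
        ≤ C * ENNReal.ofReal ((1 - ‖z‖ ^ 2) ^ (-t)) := by
  obtain ⟨C, hC, h⟩ := exists_forelliRudin_le n ht₀ ht (Nat.zero_le (n + 1))
  refine ⟨C * ENNReal.ofReal (2 ^ t), ENNReal.mul_lt_top hC ENNReal.ofReal_lt_top,
    fun z hz => ?_⟩
  have hs := one_sub_norm_sq_pos hz
  have h_half : (1 - ‖z‖ ^ 2) / 2 ≤ 1 - ‖z‖ := by nlinarith [sq_nonneg (1 - ‖z‖)]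
  have h_weight : (1 - ‖z‖) ^ (-t) ≤ 2 ^ t * (1 - ‖z‖ ^ 2) ^ (-t) :=
    calc (1 - ‖z‖) ^ (-t) ≤ ((1 - ‖z‖ ^ 2) / 2) ^ (-t) :=
          Real.rpow_le_rpow_of_nonpos (by positivity) h_half (neg_nonpos.2 ht₀.le)
      _ = 2 ^ t * (1 - ‖z‖ ^ 2) ^ (-t) := by
          rw [Real.div_rpow hs.le zero_le_two, Real.rpow_neg zero_le_two, div_inv_eq_mul, mul_comm]
  calc ∫⁻ w, ‖K w z‖ₑ * ENNReal.ofReal ((1 - ‖w‖ ^ 2) ^ (-t)) ∂(vol n)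
      = forelliRudin t (n + 1 + 0) z := by
        refine lintegral_congr fun w => ?_
        rw [mul_comm, ← ofReal_norm, norm_K_comm, K, norm_inv, norm_pow, add_zero]
    _ ≤ C * ENNReal.ofReal ((1 - ‖z‖) ^ (-((0 : ℕ) + t))) := h z hz
    _ ≤ C * ENNReal.ofReal (2 ^ t) * ENNReal.ofReal ((1 - ‖z‖ ^ 2) ^ (-t)) := by
        rw [mul_assoc, ← ENNReal.ofReal_mul (by positivity), Nat.cast_zero, zero_add]
        gcongr

end ForelliRudin

/-! ### The Schur test -/

section SchurTest

variable {α β : Type*} [MeasurableSpace α] [MeasurableSpace β] {p q : ℝ} {C₁ C₂ : ℝ≥0∞}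

theorem lintegral_mul_rpow_le {ν : Measure β} (hpq : p.HolderConjugate q) {r b f : β → ℝ≥0∞}
    (hr : Measurable r) (hb : Measurable b) (hb₀ : ∀ᵐ y ∂ν, b y ≠ 0 ∧ b y ≠ ⊤)
    (hf : Measurable f) :
    (∫⁻ y, r y * f y ∂ν) ^ p
      ≤ (∫⁻ y, r y * b y ^ q ∂ν) ^ (p / q) * ∫⁻ y, r y * (b y ^ (-p) * f y ^ p) ∂ν := by
  have hp := hpq.pos
  have hq := hpq.symm.pos
  set g : β → ℝ≥0∞ := fun y => r y ^ p⁻¹ * ((b y)⁻¹ * f y) with hg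
  set h : β → ℝ≥0∞ := fun y => r y ^ q⁻¹ * b y with hh
  have h_split : ∫⁻ y, r y * f y ∂ν = ∫⁻ y, (g * h) y ∂ν := by
    refine lintegral_congr_ae ?_
    filter_upwards [hb₀] with y hy
    calc r y * f y = r y ^ (p⁻¹ + q⁻¹) * ((b y)⁻¹ * b y) * f y := by
          rw [hpq.inv_add_inv_eq_one, ENNReal.rpow_one, ENNReal.inv_mul_cancel hy.1 hy.2, mul_one]
      _ = (g * h) y := by
          rw [ENNReal.rpow_add_of_nonneg _ _ (inv_nonneg.2 hp.le) (inv_nonneg.2 hq.le),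
            Pi.mul_apply]
          ring
  have hg_rpow : ∀ y, g y ^ p = r y * (b y ^ (-p) * f y ^ p) := fun y => by
    rw [hg, ENNReal.mul_rpow_of_nonneg _ _ hp.le, ENNReal.mul_rpow_of_nonneg _ _ hp.le,
      ← ENNReal.rpow_mul, inv_mul_cancel₀ hp.ne', ENNReal.rpow_one, ENNReal.inv_rpow,
      ENNReal.rpow_neg]
  have hh_rpow : ∀ y, h y ^ q = r y * b y ^ q := fun y => by
    rw [hh, ENNReal.mul_rpow_of_nonneg _ _ hq.le, ← ENNReal.rpow_mul, inv_mul_cancel₀ hq.ne',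
      ENNReal.rpow_one]
  have h_holder := ENNReal.lintegral_mul_le_Lp_mul_Lq ν hpq (f := g) (g := h)
    ((hr.pow_const _).mul (hb.inv.mul hf)).aemeasurable ((hr.pow_const _).mul hb).aemeasurable
  simp only [hg_rpow, hh_rpow, ← h_split] at h_holder
  refine (ENNReal.rpow_le_rpow h_holder hp.le).trans_eq ?_
  rw [ENNReal.mul_rpow_of_nonneg _ _ hp.le, ← ENNReal.rpow_mul, ← ENNReal.rpow_mul,
    one_div_mul_cancel hp.ne', ENNReal.rpow_one, one_div_mul_eq_div, mul_comm]

theorem lintegral_mul_rpow_le_of_le {ν : Measure β} (hpq : p.HolderConjugate q)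
    {r b f : β → ℝ≥0∞} {a C : ℝ≥0∞} (hr : Measurable r) (hb : Measurable b)
    (hb₀ : ∀ᵐ y ∂ν, b y ≠ 0 ∧ b y ≠ ⊤) (hf : Measurable f)
    (h : ∫⁻ y, r y * b y ^ q ∂ν ≤ C * a ^ q) :
    (∫⁻ y, r y * f y ∂ν) ^ p
      ≤ C ^ (p / q) * ∫⁻ y, r y * a ^ p * (b y ^ (-p) * f y ^ p) ∂ν := by
  have hp := hpq.pos
  have hq := hpq.symm.pos
  have h_meas : Measurable fun y => r y * (b y ^ (-p) * f y ^ p) :=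
    hr.mul ((hb.pow_const _).mul (hf.pow_const _))
  calc (∫⁻ y, r y * f y ∂ν) ^ p
      ≤ (C * a ^ q) ^ (p / q) * ∫⁻ y, r y * (b y ^ (-p) * f y ^ p) ∂ν :=
        (lintegral_mul_rpow_le hpq hr hb hb₀ hf).trans (by gcongr)
    _ = C ^ (p / q) * (a ^ p * ∫⁻ y, r y * (b y ^ (-p) * f y ^ p) ∂ν) := by
        rw [ENNReal.mul_rpow_of_nonneg _ _ (by positivity), ← ENNReal.rpow_mul,
          mul_div_cancel₀ p hq.ne', mul_assoc]
    _ = C ^ (p / q) * ∫⁻ y, r y * a ^ p * (b y ^ (-p) * f y ^ p) ∂ν := by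
        rw [← lintegral_const_mul _ h_meas]
        simp only [mul_assoc, mul_left_comm (a ^ p)]

theorem lintegral_lintegral_mul_rpow_le {μ : Measure α} {ν : Measure β} [SFinite μ] [SFinite ν]
    (hpq : p.HolderConjugate q) {R : α → β → ℝ≥0∞} (hR : Measurable (Function.uncurry R))
    {a : α → ℝ≥0∞} (ha : Measurable a) {b f : β → ℝ≥0∞} (hb : Measurable b)
    (hb₀ : ∀ᵐ y ∂ν, b y ≠ 0 ∧ b y ≠ ⊤) (hf : Measurable f)
    (h₁ : ∀ᵐ x ∂μ, ∫⁻ y, R x y * b y ^ q ∂ν ≤ C₁ * a x ^ q)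
    (h₂ : ∀ᵐ y ∂ν, ∫⁻ x, R x y * a x ^ p ∂μ ≤ C₂ * b y ^ p) :
    ∫⁻ x, (∫⁻ y, R x y * f y ∂ν) ^ p ∂μ ≤ C₁ ^ (p / q) * C₂ * ∫⁻ y, f y ^ p ∂ν := by
  set Q : α → β → ℝ≥0∞ := fun x y => R x y * a x ^ p * (b y ^ (-p) * f y ^ p)
  have hQ : Measurable (Function.uncurry Q) :=
    (hR.mul ((ha.comp measurable_fst).pow_const _)).mul
      (((hb.comp measurable_snd).pow_const _).mul ((hf.comp measurable_snd).pow_const _))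
  have hR_right : ∀ y, Measurable fun x => R x y := fun y => hR.comp measurable_prodMk_right
  have h_pointwise : ∀ᵐ x ∂μ, (∫⁻ y, R x y * f y ∂ν) ^ p ≤ C₁ ^ (p / q) * ∫⁻ y, Q x y ∂ν := by
    filter_upwards [h₁] with x hx
    exact lintegral_mul_rpow_le_of_le hpq (hR.comp measurable_prodMk_left) hb hb₀ hf hx
  calc ∫⁻ x, (∫⁻ y, R x y * f y ∂ν) ^ p ∂μ
      ≤ ∫⁻ x, C₁ ^ (p / q) * ∫⁻ y, Q x y ∂ν ∂μ := lintegral_mono_ae h_pointwise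
    _ = C₁ ^ (p / q) * ∫⁻ y, (∫⁻ x, R x y * a x ^ p ∂μ) * (b y ^ (-p) * f y ^ p) ∂ν := by
        have h_meas : Measurable fun x => ∫⁻ y, Q x y ∂ν := hQ.lintegral_prod_right'
        rw [lintegral_const_mul _ h_meas,
          lintegral_lintegral_swap hQ.aemeasurable]
        exact congrArg _ (lintegral_congr fun y =>
          lintegral_mul_const _ ((hR_right y).mul (ha.pow_const _)))
    _ ≤ C₁ ^ (p / q) * ∫⁻ y, C₂ * f y ^ p ∂ν := by
        refine mul_le_mul_right (lintegral_mono_ae ?_) _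
        filter_upwards [h₂, hb₀] with y hy hy₀
        refine (mul_le_mul_left hy _).trans_eq ?_
        rw [mul_assoc, ← mul_assoc (b y ^ p), ENNReal.rpow_neg, ENNReal.mul_inv_cancel, one_mul]
        · exact (ENNReal.rpow_pos (pos_iff_ne_zero.2 hy₀.1) hy₀.2).ne'
        · exact ENNReal.rpow_ne_top_of_nonneg hpq.nonneg hy₀.2
    _ = C₁ ^ (p / q) * C₂ * ∫⁻ y, f y ^ p ∂ν := by
        rw [lintegral_const_mul _ (hf.pow_const _), mul_assoc]

theorem ofReal_one_sub_norm_sq_rpow_rpow {n : ℕ} {z : Cn n} (hz : z ∈ unitBall n) (s t : ℝ) :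
    ENNReal.ofReal ((1 - ‖z‖ ^ 2) ^ s) ^ t = ENNReal.ofReal ((1 - ‖z‖ ^ 2) ^ (s * t)) := by
  have hs := one_sub_norm_sq_pos hz
  rw [ENNReal.ofReal_rpow_of_pos (Real.rpow_pos_of_pos hs _), ← Real.rpow_mul hs.le]

theorem lintegral_rpow_le_of_weight {n : ℕ} {δ : ℝ} (hpq : p.HolderConjugate q)
    {R : Cn n → Cn n → ℝ≥0∞} (hR : Measurable (Function.uncurry R)) {f : Cn n → ℝ≥0∞}
    (hf : Measurable f)
    (h₁ : ∀ z ∈ unitBall n, ∫⁻ w, R z w * ENNReal.ofReal ((1 - ‖w‖ ^ 2) ^ (-(δ / p))) ∂(vol n)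
      ≤ C₁ * ENNReal.ofReal ((1 - ‖z‖ ^ 2) ^ (-(δ / p))))
    (h₂ : ∀ w ∈ unitBall n, ∫⁻ z, R z w * ENNReal.ofReal ((1 - ‖z‖ ^ 2) ^ (-(δ / q))) ∂(vol n)
      ≤ C₂ * ENNReal.ofReal ((1 - ‖w‖ ^ 2) ^ (-(δ / q)))) :
    ∫⁻ z, (∫⁻ w, R z w * f w ∂(vol n)) ^ p ∂(vol n)
      ≤ C₁ ^ (p / q) * C₂ * ∫⁻ w, f w ^ p ∂(vol n) := by
  set a : Cn n → ℝ≥0∞ := fun w => ENNReal.ofReal ((1 - ‖w‖ ^ 2) ^ (-(δ / (p * q)))) with ha_def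
  have ha : Measurable a := by fun_prop
  have ha₀ : ∀ᵐ w ∂(vol n), a w ≠ 0 ∧ a w ≠ ⊤ := by
    filter_upwards [ae_mem_unitBall n] with w hw
    exact ⟨(ENNReal.ofReal_pos.2 (Real.rpow_pos_of_pos (one_sub_norm_sq_pos hw) _)).ne',
      ENNReal.ofReal_ne_top⟩
  have haq : ∀ w ∈ unitBall n, a w ^ q = ENNReal.ofReal ((1 - ‖w‖ ^ 2) ^ (-(δ / p))) :=
    fun w hw => by
      rw [ha_def, ofReal_one_sub_norm_sq_rpow_rpow hw, neg_mul, ← div_div,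
        div_mul_cancel₀ _ hpq.symm.ne_zero]
  have hap : ∀ w ∈ unitBall n, a w ^ p = ENNReal.ofReal ((1 - ‖w‖ ^ 2) ^ (-(δ / q))) :=
    fun w hw => by
      rw [ha_def, ofReal_one_sub_norm_sq_rpow_rpow hw, neg_mul, mul_comm p, ← div_div,
        div_mul_cancel₀ _ hpq.ne_zero]
  refine lintegral_lintegral_mul_rpow_le hpq hR ha ha ha₀ hf ?_ ?_
  · filter_upwards [ae_mem_unitBall n] with z hz
    refine (lintegral_mono_ae ?_).trans ((h₁ z hz).trans_eq (by rw [haq z hz]))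
    filter_upwards [ae_mem_unitBall n] with w hw using by rw [haq w hw]
  · filter_upwards [ae_mem_unitBall n] with w hw
    refine (lintegral_mono_ae ?_).trans ((h₂ w hw).trans_eq (by rw [hap w hw]))
    filter_upwards [ae_mem_unitBall n] with z hz using by rw [hap z hz]

end SchurTest

/-! ### The Bergman projection -/

section Projection

variable {n : ℕ} {z w : Cn n} {p : ℝ≥0∞}

theorem measurable_K (n : ℕ) : Measurable fun q : Cn n × Cn n => K q.1 q.2 := by
  unfold K
  fun_prop

theorem one_sub_le_norm_one_sub_inner {r : ℝ} (hw : w ∈ unitBall n) (hz : ‖z‖ ≤ r) :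
    1 - r ≤ ‖(1 - inner ℂ w z : ℂ)‖ := by
  have h_inner : ‖(inner ℂ w z : ℂ)‖ ≤ r := (norm_inner_le_norm w z).trans
    ((mul_le_of_le_one_left (norm_nonneg z) (mem_unitBall.1 hw).le).trans hz)
  have h_sub := norm_sub_norm_le (1 : ℂ) (inner ℂ w z)
  rw [norm_one] at h_sub
  linarith

theorem norm_K_le {r : ℝ} (hr : r < 1) (hw : w ∈ unitBall n) (hz : ‖z‖ ≤ r) :
    ‖K w z‖ ≤ ((1 - r) ^ (n + 1))⁻¹ := by
  have hr_pos : 0 < 1 - r := sub_pos.2 hr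
  rw [K, norm_inv, norm_pow]
  gcongr
  exact one_sub_le_norm_one_sub_inner hw hz

/-- The complex derivative of `K_w` at `x`. -/
def KDeriv (w x : Cn n) : Cn n →L[ℂ] ℂ :=
  ((n + 1 : ℕ) * ((1 - inner ℂ w x) ^ (n + 2))⁻¹ : ℂ) • innerSL ℂ w

theorem hasFDerivAt_K (hw : w ∈ unitBall n) (hz : z ∈ unitBall n) :
    HasFDerivAt (K w) (KDeriv w z) z := by
  have h_ne := one_sub_inner_ne_zero hw hz
  have h_inner : HasFDerivAt (fun x : Cn n => (1 - inner ℂ w x : ℂ)) (-innerSL ℂ w) z :=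
    (innerSL ℂ w).hasFDerivAt.const_sub 1
  refine (((hasDerivAt_pow (n + 1) (1 - inner ℂ w z : ℂ)).inv
    (pow_ne_zero _ h_ne)).comp_hasFDerivAt z h_inner).congr_fderiv ?_
  rw [KDeriv, smul_neg, ← neg_smul]
  congr 1
  push_cast
  field_simp
  ring

theorem norm_KDeriv_le {r : ℝ} (hr : r < 1) (hw : w ∈ unitBall n) (hz : ‖z‖ ≤ r) :
    ‖KDeriv w z‖ ≤ (n + 1 : ℕ) * ((1 - r) ^ (n + 2))⁻¹ := by
  have hr_pos : 0 < 1 - r := sub_pos.2 hr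
  rw [KDeriv, norm_smul, innerSL_apply_norm, norm_mul, norm_inv, norm_pow, Complex.norm_natCast]
  refine (mul_le_of_le_one_right (by positivity) (mem_unitBall.1 hw).le).trans ?_
  gcongr
  exact one_sub_le_norm_one_sub_inner hw hz

theorem aestronglyMeasurable_KDeriv (z : Cn n) :
    AEStronglyMeasurable (fun w => KDeriv w z) (vol n) := by
  have h_coeff : Measurable fun w : Cn n =>
      ((n + 1 : ℕ) * ((1 - inner ℂ w z) ^ (n + 2))⁻¹ : ℂ) := by
    fun_prop
  exact h_coeff.aestronglyMeasurable.smul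
    (innerSL ℂ : Cn n →L⋆[ℂ] Cn n →L[ℂ] ℂ).continuous.aestronglyMeasurable

theorem differentiableOn_projFun {f : Cn n → ℂ} (hf : Integrable f (vol n)) :
    DifferentiableOn ℂ (projFun f) (unitBall n) := by
  intro z hz
  obtain ⟨r, hzr, hr⟩ := exists_between (mem_unitBall.1 hz)
  have h_nhds : Metric.ball (0 : Cn n) r ∈ 𝓝 z :=
    Metric.isOpen_ball.mem_nhds (mem_ball_zero_iff.2 hzr)
  have h_norm : ∀ x ∈ Metric.ball (0 : Cn n) r, ‖x‖ ≤ r := fun x hx =>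
    (mem_ball_zero_iff.1 hx).le
  have h_mem : ∀ x ∈ Metric.ball (0 : Cn n) r, x ∈ unitBall n := fun x hx =>
    mem_unitBall.2 ((h_norm x hx).trans_lt hr)
  refine (hasFDerivAt_integral_of_dominated_of_fderiv_le (F' := fun x w => f w • KDeriv w x)
    (bound := fun w => ‖f w‖ * ((n + 1 : ℕ) * ((1 - r) ^ (n + 2))⁻¹)) h_nhds ?_
    (integrable_K_mul hf hz) ?_ ?_ (hf.norm.mul_const _)
    ?_).differentiableAt.differentiableWithinAt
  · filter_upwards [h_nhds] with x hx
    exact (integrable_K_mul hf (h_mem x hx)).aestronglyMeasurable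
  · exact hf.aestronglyMeasurable.smul (aestronglyMeasurable_KDeriv z)
  · filter_upwards [ae_mem_unitBall n] with w hw x hx
    rw [norm_smul]
    gcongr
    exact norm_KDeriv_le hr hw (h_norm x hx)
  · filter_upwards [ae_mem_unitBall n] with w hw x hx
    exact (hasFDerivAt_K hw (h_mem x hx)).mul_const (f w)

theorem holderConjugate_toReal (hp : 1 < p) (hp' : p ≠ ⊤) :
    p.toReal.HolderConjugate p.toReal.conjExponent :=
  Real.HolderConjugate.conjExponent ((ENNReal.toReal_lt_toReal ENNReal.one_ne_top hp').2 hp)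

theorem eLpNorm_le_of_lintegral_rpow_le {α E F : Type*} [MeasurableSpace α] {μ : Measure α}
    [ENorm E] [ENorm F] (hp₀ : p ≠ 0) (hp' : p ≠ ⊤) {f : α → E} {g : α → F} {C : ℝ≥0∞}
    (h : ∫⁻ x, ‖g x‖ₑ ^ p.toReal ∂μ ≤ C * ∫⁻ x, ‖f x‖ₑ ^ p.toReal ∂μ) :
    eLpNorm g p μ ≤ C ^ (1 / p.toReal) * eLpNorm f p μ := by
  rw [eLpNorm_eq_lintegral_rpow_enorm_toReal hp₀ hp',
    eLpNorm_eq_lintegral_rpow_enorm_toReal hp₀ hp',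
    ← ENNReal.mul_rpow_of_nonneg _ _ (by positivity)]
  exact ENNReal.rpow_le_rpow h (by positivity)

theorem exists_eLpNorm_projFun_le (n : ℕ) (hp : 1 < p) (hp' : p ≠ ⊤) :
    ∃ C : ℝ≥0∞, C < ⊤ ∧ ∀ f : LpBall n p,
      eLpNorm (projFun f) p (vol n) ≤ C * eLpNorm f p (vol n) := by
  have hpq := holderConjugate_toReal hp hp'
  set q := p.toReal.conjExponent
  have hp_pos := hpq.pos
  have hq_pos := hpq.symm.pos
  obtain ⟨C₁, hC₁, h₁⟩ := exists_lintegral_K_le n (inv_pos.2 hp_pos) (inv_lt_one_of_one_lt₀ hpq.lt)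
  obtain ⟨C₂, hC₂, h₂⟩ := exists_lintegral_K_le n (inv_pos.2 hq_pos)
    (inv_lt_one_of_one_lt₀ hpq.symm.lt)
  refine ⟨(C₁ ^ (p.toReal / q) * C₂) ^ (1 / p.toReal), ?_, fun f =>
    eLpNorm_le_of_lintegral_rpow_le (zero_lt_one.trans hp).ne' hp' ?_⟩
  · exact ENNReal.rpow_lt_top_of_nonneg (by positivity) (ENNReal.mul_ne_top
      (ENNReal.rpow_ne_top_of_nonneg (by positivity) hC₁.ne) hC₂.ne)
  · calc ∫⁻ z, ‖projFun f z‖ₑ ^ p.toReal ∂(vol n)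
        ≤ ∫⁻ z, (∫⁻ w, ‖K w z‖ₑ * ‖f w‖ₑ ∂(vol n)) ^ p.toReal ∂(vol n) := by
          simp only [← enorm_mul]
          exact lintegral_mono fun z => ENNReal.rpow_le_rpow
            (enorm_integral_le_lintegral_enorm _) hp_pos.le
      _ ≤ C₁ ^ (p.toReal / q) * C₂ * ∫⁻ w, ‖f w‖ₑ ^ p.toReal ∂(vol n) := by
          refine lintegral_rpow_le_of_weight (δ := 1) hpq
            ((measurable_K n).comp measurable_swap).enorm (Lp.stronglyMeasurable f).enorm ?_ ?_
          · simpa only [one_div] using h₁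
          · simpa only [one_div, ← ofReal_norm, norm_K_comm] using h₂

variable [Fact (1 ≤ p)]

theorem integrable_coeFn (f : LpBall n p) : Integrable f (vol n) :=
  memLp_one_iff_integrable.1 ((Lp.memLp f).mono_exponent Fact.out)

theorem projFun_add {f g : Cn n → ℂ} (hf : Integrable f (vol n)) (hg : Integrable g (vol n))
    (hz : z ∈ unitBall n) : projFun (f + g) z = projFun f z + projFun g z := by
  simp only [projFun, Pi.add_apply, mul_add]
  exact integral_add (integrable_K_mul hf hz) (integrable_K_mul hg hz)

theorem projFun_smul (c : ℂ) (f : Cn n → ℂ) : projFun (c • f) = c • projFun f := by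
  ext z
  simp only [projFun, Pi.smul_apply, smul_eq_mul, mul_left_comm _ c]
  exact integral_const_mul _ _

theorem projFun_congr_ae {f g : Cn n → ℂ} (h : f =ᵐ[vol n] g) : projFun f = projFun g := by
  ext z
  refine integral_congr_ae ?_
  filter_upwards [h] with w hw
  rw [hw]

/-- The linear map `Lᵖ → Aᵖ` induced by `projFun` once `projFun` is known to preserve `Lᵖ`. -/
def projLinearMap (h : ∀ f : LpBall n p, MemLp (projFun f) p (vol n)) :
    LpBall n p →ₗ[ℂ] bergmanSpace n p where
  toFun f := ⟨(h f).toLp _, projFun f, differentiableOn_projFun (integrable_coeFn f),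
    (h f).coeFn_toLp⟩
  map_add' f g := by
    refine Subtype.ext ?_
    change (h (f + g)).toLp _ = (h f).toLp _ + (h g).toLp _
    rw [← MemLp.toLp_add]
    refine MemLp.toLp_congr _ _ ?_
    filter_upwards [ae_mem_unitBall n] with z hz
    rw [projFun_congr_ae (Lp.coeFn_add f g),
      projFun_add (integrable_coeFn f) (integrable_coeFn g) hz, Pi.add_apply]
  map_smul' c f := by
    refine Subtype.ext ?_
    change (h (c • f)).toLp _ = c • (h f).toLp _
    rw [← MemLp.toLp_const_smul]
    refine MemLp.toLp_congr _ _ (Eventually.of_forall fun z => ?_)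
    rw [projFun_congr_ae (Lp.coeFn_smul c f), projFun_smul]

theorem exists_isBergmanProjection (n : ℕ) (hp : 1 < p) (hp' : p ≠ ⊤) :
    ∃ P : LpBall n p →L[ℂ] bergmanSpace n p, IsBergmanProjection P := by
  obtain ⟨C, hC, h_le⟩ := exists_eLpNorm_projFun_le n hp hp'
  have h_lt_top : ∀ f : LpBall n p, C * eLpNorm f p (vol n) < ⊤ := fun f =>
    ENNReal.mul_lt_top hC (Lp.eLpNorm_lt_top f)
  have h_memLp : ∀ f : LpBall n p, MemLp (projFun f) p (vol n) := fun f =>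
    ⟨aestronglyMeasurable_vol_of_continuousOn
      (differentiableOn_projFun (integrable_coeFn f)).continuousOn, (h_le f).trans_lt (h_lt_top f)⟩
  refine ⟨(projLinearMap h_memLp).mkContinuous C.toReal fun f => ?_,
    fun f => (h_memLp f).coeFn_toLp⟩
  change ‖(h_memLp f).toLp _‖ ≤ _
  rw [Lp.norm_toLp, Lp.norm_def, ← ENNReal.toReal_mul]
  exact ENNReal.toReal_mono (h_lt_top f).ne (h_le f)

end Projection

/-! ### Block sums -/

section BlockSums

variable {n : ℕ} {p : ℝ≥0∞} [Fact (1 ≤ p)] {E : Set (Cn n)}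

theorem coeFn_mulInd (hE : MeasurableSet E) (f : LpBall n p) :
    mulInd E hE f =ᵐ[vol n] E.indicator f := by
  have h_toLp : mulInd E hE f = ((Lp.memLp f).indicator hE).toLp (E.indicator f) := rfl
  rw [h_toLp]
  exact MemLp.coeFn_toLp _

theorem mulInd_compl (hE : MeasurableSet E) (f : LpBall n p) :
    mulInd Eᶜ hE.compl f = f - mulInd E hE f := by
  refine Lp.ext ?_
  filter_upwards [coeFn_mulInd hE f, coeFn_mulInd hE.compl f, Lp.coeFn_sub f (mulInd E hE f)]
    with z h_ind h_compl h_sub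
  rw [h_compl, h_sub, Pi.sub_apply, h_ind, Set.indicator_compl, Pi.sub_apply]

theorem mulInd_mulInd_self (hE : MeasurableSet E) (f : LpBall n p) :
    mulInd E hE (mulInd E hE f) = mulInd E hE f := by
  refine Lp.ext ?_
  filter_upwards [coeFn_mulInd hE f, coeFn_mulInd hE (mulInd E hE f)] with z h_one h_two
  rw [h_two, h_one]
  by_cases h : z ∈ E
  · rw [Set.indicator_of_mem h, h_one]
  · rw [Set.indicator_of_notMem h, Set.indicator_of_notMem h]

theorem mulInd_mulInd_of_disjoint {E' : Set (Cn n)} (hE : MeasurableSet E)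
    (hE' : MeasurableSet E') (h_disj : Disjoint E E') (f : LpBall n p) :
    mulInd E hE (mulInd E' hE' f) = 0 := by
  refine Lp.ext ?_
  filter_upwards [coeFn_mulInd hE' f, coeFn_mulInd hE (mulInd E' hE' f),
    Lp.coeFn_zero ℂ p (vol n)] with z h_inner h_outer h_zero
  rw [h_outer, h_zero, Pi.zero_apply, Set.indicator_apply_eq_zero, h_inner]
  exact fun h => Set.indicator_of_notMem (Set.disjoint_left.1 h_disj h) _

theorem toReal_pos_of_fact (hp' : p ≠ ⊤) : 0 < p.toReal :=
  ENNReal.toReal_pos (zero_lt_one.trans_le (Fact.out : 1 ≤ p)).ne' hp'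

theorem enorm_rpow_eq_lintegral (hp' : p ≠ ⊤) (f : LpBall n p) :
    ‖f‖ₑ ^ p.toReal = ∫⁻ z, ‖f z‖ₑ ^ p.toReal ∂(vol n) := by
  have hp₀ : p ≠ 0 := (zero_lt_one.trans_le (Fact.out : 1 ≤ p)).ne'
  rw [Lp.enorm_def, eLpNorm_eq_lintegral_rpow_enorm_toReal hp₀ hp', ← ENNReal.rpow_mul,
    one_div_mul_cancel (toReal_pos_of_fact hp').ne', ENNReal.rpow_one]

theorem enorm_mulInd_rpow (hp' : p ≠ ⊤) (hE : MeasurableSet E) (f : LpBall n p) :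
    ‖mulInd E hE f‖ₑ ^ p.toReal = ∫⁻ z, E.indicator (fun z => ‖f z‖ₑ ^ p.toReal) z ∂(vol n) := by
  rw [enorm_rpow_eq_lintegral hp']
  refine lintegral_congr_ae ?_
  filter_upwards [coeFn_mulInd hE f] with z hz
  rw [hz]
  by_cases h : z ∈ E
  · rw [Set.indicator_of_mem h, Set.indicator_of_mem h]
  · rw [Set.indicator_of_notMem h, Set.indicator_of_notMem h, enorm_zero,
      ENNReal.zero_rpow_of_pos (toReal_pos_of_fact hp')]

theorem enorm_mulInd_le (hE : MeasurableSet E) (f : LpBall n p) : ‖mulInd E hE f‖ₑ ≤ ‖f‖ₑ := by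
  rw [Lp.enorm_def, Lp.enorm_def, eLpNorm_congr_ae (coeFn_mulInd hE f)]
  exact eLpNorm_indicator_le _

variable {ι : Type*} {F G : ι → Set (Cn n)} {N : ℕ}

theorem card_filter_mem_le {z : Cn n} [DecidablePred fun j => z ∈ G j]
    (hN : {j | z ∈ G j}.encard ≤ N) (s : Finset ι) : (s.filter fun j => z ∈ G j).card ≤ N := by
  have h_subset : ((s.filter fun j => z ∈ G j : Finset ι) : Set ι) ⊆ {j | z ∈ G j} :=
    fun j hj => (Finset.mem_filter.1 hj).2
  have h_card := (Set.encard_le_encard h_subset).trans hN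
  rwa [Set.encard_coe_eq_coe_finsetCard, Nat.cast_le] at h_card

theorem sum_enorm_mulInd_rpow_le (hp' : p ≠ ⊤) (hG : ∀ j, MeasurableSet (G j))
    (hN : ∀ z ∈ unitBall n, {j | z ∈ G j}.encard ≤ N) (f : LpBall n p) (s : Finset ι) :
    ∑ j ∈ s, ‖mulInd (G j) (hG j) f‖ₑ ^ p.toReal ≤ N * ‖f‖ₑ ^ p.toReal := by
  classical
  have h_meas : Measurable fun z => ‖f z‖ₑ ^ p.toReal :=
    (Lp.stronglyMeasurable f).enorm.pow_const _
  simp only [enorm_mulInd_rpow hp']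
  rw [← lintegral_finsetSum _ fun j _ => h_meas.indicator (hG j), enorm_rpow_eq_lintegral hp',
    ← lintegral_const_mul _ h_meas]
  refine lintegral_mono_ae ?_
  filter_upwards [ae_mem_unitBall n] with z hz
  simp only [Set.indicator_apply]
  rw [← Finset.sum_filter, Finset.sum_const, nsmul_eq_mul]
  gcongr
  exact card_filter_mem_le (hN z hz) s

theorem enorm_finsetSum_indicator_rpow {r : ℝ} (hr : 0 < r)
    (h_disj : Pairwise fun i j => Disjoint (F i) (F j)) (u : ι → Cn n → ℂ) (s : Finset ι)
    (z : Cn n) :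
    ‖∑ j ∈ s, (F j).indicator (u j) z‖ₑ ^ r
      = ∑ j ∈ s, (F j).indicator (fun z => ‖u j z‖ₑ ^ r) z := by
  by_cases h : ∃ i ∈ s, z ∈ F i
  · obtain ⟨i, hi, hzi⟩ := h
    have h_notMem : ∀ j ∈ s, j ≠ i → z ∉ F j := fun j _ hj hzj =>
      Set.disjoint_left.1 (h_disj hj) hzj hzi
    rw [Finset.sum_eq_single_of_mem i hi fun j hs hj =>
        Set.indicator_of_notMem (h_notMem j hs hj) _,
      Finset.sum_eq_single_of_mem i hi fun j hs hj =>
        Set.indicator_of_notMem (h_notMem j hs hj) _,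
      Set.indicator_of_mem hzi, Set.indicator_of_mem hzi]
  · push Not at h
    rw [Finset.sum_eq_zero fun j hj => Set.indicator_of_notMem (h j hj) _,
      Finset.sum_eq_zero fun j hj => Set.indicator_of_notMem (h j hj) _, enorm_zero,
      ENNReal.zero_rpow_of_pos hr]

theorem enorm_sum_mulInd_rpow (hp' : p ≠ ⊤) (hF : ∀ j, MeasurableSet (F j))
    (h_disj : Pairwise fun i j => Disjoint (F i) (F j)) (u : ι → LpBall n p) (s : Finset ι) :
    ‖∑ j ∈ s, mulInd (F j) (hF j) (u j)‖ₑ ^ p.toReal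
      = ∑ j ∈ s, ‖mulInd (F j) (hF j) (u j)‖ₑ ^ p.toReal := by
  simp only [enorm_mulInd_rpow hp']
  rw [enorm_rpow_eq_lintegral hp', ← lintegral_finsetSum _ fun j _ =>
    ((Lp.stronglyMeasurable (u j)).enorm.pow_const _).indicator (hF j)]
  refine lintegral_congr_ae ?_
  have h_ind : ∀ᵐ z ∂(vol n), ∀ j ∈ s, mulInd (F j) (hF j) (u j) z = (F j).indicator (u j) z :=
    (Finset.eventually_all s).2 fun j _ => coeFn_mulInd (hF j) (u j)
  filter_upwards [h_ind, Lp.coeFn_fun_finsetSum s fun j => mulInd (F j) (hF j) (u j)]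
    with z h_ind h_sum
  rw [h_sum, Finset.sum_congr rfl h_ind,
    enorm_finsetSum_indicator_rpow (toReal_pos_of_fact hp') h_disj]

theorem sum_enorm_mulInd_comp_rpow_le (hp' : p ≠ ⊤) (hF : ∀ j, MeasurableSet (F j))
    (hG : ∀ j, MeasurableSet (G j)) (hN : ∀ z ∈ unitBall n, {j | z ∈ G j}.encard ≤ N)
    (A : LpBall n p →L[ℂ] LpBall n p) (f : LpBall n p) (s : Finset ι) :
    ∑ j ∈ s, ‖mulInd (F j) (hF j) (A (mulInd (G j) (hG j) f))‖ₑ ^ p.toReal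
      ≤ ‖A‖ₑ ^ p.toReal * (N * ‖f‖ₑ ^ p.toReal) := by
  have hp₀ := toReal_pos_of_fact hp'
  calc ∑ j ∈ s, ‖mulInd (F j) (hF j) (A (mulInd (G j) (hG j) f))‖ₑ ^ p.toReal
      ≤ ∑ j ∈ s, ‖A‖ₑ ^ p.toReal * ‖mulInd (G j) (hG j) f‖ₑ ^ p.toReal := by
        refine Finset.sum_le_sum fun j _ => ?_
        rw [← ENNReal.mul_rpow_of_nonneg _ _ hp₀.le]
        exact ENNReal.rpow_le_rpow ((enorm_mulInd_le _ _).trans (A.le_opENorm _)) hp₀.le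
    _ ≤ ‖A‖ₑ ^ p.toReal * (N * ‖f‖ₑ ^ p.toReal) := by
        rw [← Finset.mul_sum]
        gcongr
        exact sum_enorm_mulInd_rpow_le hp' hG hN f s

theorem norm_sum_mulInd_comp_le (hp' : p ≠ ⊤) (hF : ∀ j, MeasurableSet (F j))
    (h_disj : Pairwise fun i j => Disjoint (F i) (F j)) (hG : ∀ j, MeasurableSet (G j))
    (hN : ∀ z ∈ unitBall n, {j | z ∈ G j}.encard ≤ N)
    (A : LpBall n p →L[ℂ] LpBall n p) (f : LpBall n p) (s : Finset ι) :
    ‖∑ j ∈ s, mulInd (F j) (hF j) (A (mulInd (G j) (hG j) f))‖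
      ≤ (N : ℝ) ^ (1 / p.toReal) * ‖A‖ * ‖f‖ := by
  have hp₀ := toReal_pos_of_fact hp'
  have h_le := ENNReal.toReal_mono (by finiteness)
    ((enorm_sum_mulInd_rpow hp' hF h_disj (fun j => A (mulInd (G j) (hG j) f)) s).trans_le
      (sum_enorm_mulInd_comp_rpow_le hp' hF hG hN A f s))
  simp only [ENNReal.toReal_mul, ← ENNReal.toReal_rpow, toReal_enorm, ENNReal.toReal_natCast]
    at h_le
  rw [← Real.rpow_le_rpow_iff (norm_nonneg _) (by positivity) hp₀,
    Real.mul_rpow (by positivity) (norm_nonneg _), Real.mul_rpow (by positivity) (norm_nonneg _),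
    ← Real.rpow_mul (by positivity), one_div_mul_cancel hp₀.ne', Real.rpow_one]
  linarith

theorem norm_sum_mulInd_rpow (hp' : p ≠ ⊤) (hF : ∀ j, MeasurableSet (F j))
    (h_disj : Pairwise fun i j => Disjoint (F i) (F j)) (u : ι → LpBall n p) (s : Finset ι) :
    ‖∑ j ∈ s, mulInd (F j) (hF j) (u j)‖ ^ p.toReal
      = ∑ j ∈ s, ‖mulInd (F j) (hF j) (u j)‖ ^ p.toReal := by
  have h_eq := congrArg ENNReal.toReal (enorm_sum_mulInd_rpow hp' hF h_disj u s)
  rw [ENNReal.toReal_sum fun j _ => by finiteness] at h_eq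
  simpa only [← ENNReal.toReal_rpow, toReal_enorm] using h_eq

theorem summable_mulInd (hp' : p ≠ ⊤) (hF : ∀ j, MeasurableSet (F j))
    (h_disj : Pairwise fun i j => Disjoint (F i) (F j)) {u : ι → LpBall n p} {C : ℝ}
    (hC : ∀ s : Finset ι, ‖∑ j ∈ s, mulInd (F j) (hF j) (u j)‖ ≤ C) :
    Summable fun j => mulInd (F j) (hF j) (u j) := by
  have hp₀ := toReal_pos_of_fact hp'
  have h_rpow := norm_sum_mulInd_rpow hp' hF h_disj u
  have h_summable : Summable fun j => ‖mulInd (F j) (hF j) (u j)‖ ^ p.toReal := by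
    refine summable_of_sum_le (fun j => by positivity) (c := C ^ p.toReal) fun s => ?_
    rw [← h_rpow]
    exact Real.rpow_le_rpow (norm_nonneg _) (hC s) hp₀.le
  rw [summable_iff_vanishing_norm] at h_summable ⊢
  intro ε hε
  obtain ⟨s, hs⟩ := h_summable (ε ^ p.toReal) (Real.rpow_pos_of_pos hε _)
  refine ⟨s, fun t ht => ?_⟩
  have h_lt := hs t ht
  rw [← h_rpow, Real.norm_of_nonneg (by positivity)] at h_lt
  exact (Real.rpow_lt_rpow_iff (norm_nonneg _) hε.le hp₀).1 h_lt

/-- `S` is the strong, unconditional sum of the operators `M_{1_{F_j}} A M_{1_{G_j}}`. -/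
def IsBlockSum (hF : ∀ j, MeasurableSet (F j)) (hG : ∀ j, MeasurableSet (G j))
    (A S : LpBall n p →L[ℂ] LpBall n p) : Prop :=
  ∀ f, HasSum (fun j => mulInd (F j) (hF j) (A (mulInd (G j) (hG j) f))) (S f)

variable {hF : ∀ j, MeasurableSet (F j)} {hG : ∀ j, MeasurableSet (G j)}
  {A A' S S' : LpBall n p →L[ℂ] LpBall n p}

theorem IsBlockSum.sub (hS : IsBlockSum hF hG A S) (hS' : IsBlockSum hF hG A' S') :
    IsBlockSum hF hG (A - A') (S - S') := fun f => by
  simpa only [sub_apply, map_sub] using (hS f).sub (hS' f)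

theorem IsBlockSum.norm_le (hS : IsBlockSum hF hG A S) (hp' : p ≠ ⊤)
    (h_disj : Pairwise fun i j => Disjoint (F i) (F j))
    (hN : ∀ z ∈ unitBall n, {j | z ∈ G j}.encard ≤ N) :
    ‖S‖ ≤ (N : ℝ) ^ (1 / p.toReal) * ‖A‖ :=
  S.opNorm_le_bound (by positivity) fun f =>
    le_of_tendsto (hS f).norm (Eventually.of_forall fun s =>
      norm_sum_mulInd_comp_le hp' hF h_disj hG hN A f s)

theorem exists_isBlockSum (hp' : p ≠ ⊤) (hF : ∀ j, MeasurableSet (F j))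
    (h_disj : Pairwise fun i j => Disjoint (F i) (F j)) (hG : ∀ j, MeasurableSet (G j))
    (hN : ∀ z ∈ unitBall n, {j | z ∈ G j}.encard ≤ N) (A : LpBall n p →L[ℂ] LpBall n p) :
    ∃ S, IsBlockSum hF hG A S := by
  have h_partial := norm_sum_mulInd_comp_le hp' hF h_disj hG hN A
  have h_hasSum := fun f => (summable_mulInd hp' hF h_disj (h_partial f)).hasSum
  refine ⟨LinearMap.mkContinuous
    { toFun := fun f => ∑' j, mulInd (F j) (hF j) (A (mulInd (G j) (hG j) f))
      map_add' := fun f g => ?_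
      map_smul' := fun c f => ?_ } ((N : ℝ) ^ (1 / p.toReal) * ‖A‖) fun f =>
        le_of_tendsto (h_hasSum f).norm (Eventually.of_forall (h_partial f)), h_hasSum⟩
  · simpa only [← map_add] using ((h_hasSum f).add (h_hasSum g)).tsum_eq
  · simpa only [← map_smul, RingHom.id_apply] using ((h_hasSum f).const_smul c).tsum_eq

theorem IsBlockSum.mulInd_apply (hS : IsBlockSum hF hG A S)
    (h_disj : Pairwise fun i j => Disjoint (F i) (F j)) (f : LpBall n p) (j : ι) :
    mulInd (F j) (hF j) (S f) = mulInd (F j) (hF j) (A (mulInd (G j) (hG j) f)) := by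
  have h_single := hasSum_single j fun i (hi : i ≠ j) =>
    mulInd_mulInd_of_disjoint (hF j) (hF i) (h_disj hi.symm) (A (mulInd (G i) (hG i) f))
  rw [((hS f).mapL (mulInd (F j) (hF j))).unique h_single, mulInd_mulInd_self]

theorem IsBlockSum.mulInd_sub_apply (hS : IsBlockSum hF hG A S)
    (h_disj : Pairwise fun i j => Disjoint (F i) (F j)) (f : LpBall n p) (j : ι) :
    mulInd (F j) (hF j) ((A - S) f)
      = mulInd (F j) (hF j) (A (mulInd (G j)ᶜ (hG j).compl f)) := by
  rw [mulInd_compl, map_sub A, sub_apply, map_sub, map_sub, hS.mulInd_apply h_disj]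

theorem IsBlockSum.ae_sub_apply_eq [Countable ι] (hS : IsBlockSum hF hG A S)
    (h_disj : Pairwise fun i j => Disjoint (F i) (F j)) (f : LpBall n p) :
    ∀ᵐ z ∂(vol n), ∀ j, z ∈ F j → (A - S) f z = A (mulInd (G j)ᶜ (hG j).compl f) z := by
  refine ae_all_iff.2 fun j => ?_
  have h_loc := hS.mulInd_sub_apply h_disj f j
  filter_upwards [coeFn_mulInd (hF j) ((A - S) f),
    coeFn_mulInd (hF j) (A (mulInd (G j)ᶜ (hG j).compl f))] with z h_left h_right hz
  rw [Set.indicator_of_mem hz] at h_left h_right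
  rw [← h_left, ← h_right, h_loc]

end BlockSums

/-! ### The integral kernel of `TP` -/

section OperatorKernel

variable {n : ℕ} {p : ℝ≥0∞} {z w : Cn n}

/-- The reproducing kernel `K_z` as an element of `Aᵖ`, for `z` in the ball; it vanishes for the
other `z`, as `kernel n p z` does. -/
def reproKernel (n : ℕ) (p : ℝ≥0∞) (z : Cn n) : bergmanSpace n p :=
  (((1 - ‖z‖ ^ 2) ^ (((n : ℝ) + 1) / 2) : ℝ) : ℂ)⁻¹ • kernel n p z

theorem kernel_eq_smul_reproKernel (hz : z ∈ unitBall n) :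
    kernel n p z = (((1 - ‖z‖ ^ 2) ^ (((n : ℝ) + 1) / 2) : ℝ) : ℂ) • reproKernel n p z := by
  have h_ne := (Real.rpow_pos_of_pos (one_sub_norm_sq_pos hz) (((n : ℝ) + 1) / 2)).ne'
  rw [reproKernel, smul_inv_smul₀ (Complex.ofReal_ne_zero.2 h_ne)]

theorem coeFn_reproKernel (hz : z ∈ unitBall n) :
    (reproKernel n p z : LpBall n p) =ᵐ[vol n] K z := by
  rw [reproKernel, Submodule.coe_smul, kernel, dif_pos hz, ← MemLp.toLp_const_smul,
    K_eq_inv_smul_k hz]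
  exact MemLp.coeFn_toLp _

theorem projFun_reproKernel (hz : z ∈ unitBall n) (hw : w ∈ unitBall n) :
    projFun (reproKernel n p w : LpBall n p) z = K w z := by
  rw [projFun_congr_ae (coeFn_reproKernel hw),
    projFun_eq_of_differentiableOn (differentiableOn_K hw) (integrable_K hw) hz]

theorem norm_le_of_ae_norm_le (f : LpBall n p) {C : ℝ} (hC : 0 ≤ C)
    (h : ∀ᵐ x ∂(vol n), ‖f x‖ ≤ C) : ‖f‖ ≤ C := by
  simpa [measureUnivNNReal] using Lp.norm_le_of_ae_bound hC h

theorem norm_reproKernel_le {r : ℝ} (hr : r < 1) (hz : ‖z‖ ≤ r) :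
    ‖(reproKernel n p z : LpBall n p)‖ ≤ ((1 - r) ^ (n + 1))⁻¹ := by
  have hr_pos : 0 < 1 - r := sub_pos.2 hr
  refine norm_le_of_ae_norm_le _ (by positivity) ?_
  filter_upwards [coeFn_reproKernel (mem_unitBall.2 (hz.trans_lt hr)), ae_mem_unitBall n]
    with w h_coe hw
  rw [h_coe, norm_K_comm]
  exact norm_K_le hr hw hz

theorem norm_K_sub_K_le {r : ℝ} (hr : r < 1) {x : Cn n} (hx : x ∈ unitBall n) (hz : ‖z‖ < r)
    (hw : ‖w‖ < r) :
    ‖K z x - K w x‖ ≤ (n + 1 : ℕ) * ((1 - r) ^ (n + 2))⁻¹ * ‖z - w‖ := by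
  have h_norm : ∀ y ∈ Metric.ball (0 : Cn n) r, ‖y‖ ≤ r := fun y hy =>
    (mem_ball_zero_iff.1 hy).le
  rw [← conj_K x z, ← conj_K x w, ← map_sub, RCLike.norm_conj]
  exact (convex_ball (0 : Cn n) r).norm_image_sub_le_of_norm_hasFDerivWithin_le
    (fun y hy => (hasFDerivAt_K hx
      (mem_unitBall.2 ((h_norm y hy).trans_lt hr))).hasFDerivWithinAt)
    (fun y hy => norm_KDeriv_le hr hx (h_norm y hy))
    (mem_ball_zero_iff.2 hw) (mem_ball_zero_iff.2 hz)

variable [Fact (1 ≤ p)]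

theorem continuousOn_reproKernel : ContinuousOn (reproKernel n p) (unitBall n) := by
  intro z hz
  obtain ⟨r, hzr, hr⟩ := exists_between (mem_unitBall.1 hz)
  have hr_pos : 0 < 1 - r := sub_pos.2 hr
  have h_mem : ∀ x ∈ Metric.ball (0 : Cn n) r, x ∈ unitBall n := fun x hx =>
    mem_unitBall.2 ((mem_ball_zero_iff.1 hx).trans hr)
  have h_lip : LipschitzOnWith (Real.toNNReal ((n + 1 : ℕ) * ((1 - r) ^ (n + 2))⁻¹))
      (reproKernel n p) (Metric.ball 0 r) := by
    refine LipschitzOnWith.of_dist_le' fun x hx y hy => ?_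
    rw [dist_eq_norm, dist_eq_norm, ← Submodule.norm_coe, Submodule.coe_sub]
    refine norm_le_of_ae_norm_le _ (by positivity) ?_
    filter_upwards [Lp.coeFn_sub (reproKernel n p x : LpBall n p) (reproKernel n p y),
      coeFn_reproKernel (h_mem x hx), coeFn_reproKernel (h_mem y hy), ae_mem_unitBall n]
      with u h_sub h_x h_y hu
    rw [h_sub, Pi.sub_apply, h_x, h_y]
    exact norm_K_sub_K_le hr hu (mem_ball_zero_iff.1 hx) (mem_ball_zero_iff.1 hy)
  exact (h_lip.continuousOn.continuousAt
    (Metric.isOpen_ball.mem_nhds (mem_ball_zero_iff.2 hzr))).continuousWithinAt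

theorem integral_norm_le_norm (f : LpBall n p) : ∫ w, ‖f w‖ ∂(vol n) ≤ ‖f‖ := by
  rw [Lp.norm_def, integral_norm_eq_lintegral_enorm (Lp.aestronglyMeasurable f),
    ← eLpNorm_one_eq_lintegral_enorm]
  exact ENNReal.toReal_mono (Lp.eLpNorm_ne_top f)
    (eLpNorm_le_eLpNorm_of_exponent_le Fact.out (Lp.aestronglyMeasurable f))

theorem norm_projFun_le (f : LpBall n p) {r : ℝ} (hr : r < 1) (hz : ‖z‖ ≤ r) :
    ‖projFun f z‖ ≤ ((1 - r) ^ (n + 1))⁻¹ * ‖f‖ := by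
  have hr_pos : 0 < 1 - r := sub_pos.2 hr
  have h_bound : ∀ᵐ w ∂(vol n), ‖K w z * f w‖ ≤ ((1 - r) ^ (n + 1))⁻¹ * ‖f w‖ := by
    filter_upwards [ae_mem_unitBall n] with w hw
    rw [norm_mul]
    gcongr
    exact norm_K_le hr hw hz
  calc ‖projFun f z‖ ≤ ∫ w, ((1 - r) ^ (n + 1))⁻¹ * ‖f w‖ ∂(vol n) :=
        norm_integral_le_of_norm_le ((integrable_coeFn f).norm.const_mul _) h_bound
    _ = ((1 - r) ^ (n + 1))⁻¹ * ∫ w, ‖f w‖ ∂(vol n) := integral_const_mul _ _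
    _ ≤ ((1 - r) ^ (n + 1))⁻¹ * ‖f‖ := by
        gcongr
        exact integral_norm_le_norm f

/-- The functional `f ↦ (Pf)(z)` on `Lᵖ`; on `Aᵖ` it is the evaluation at `z`. -/
def evalCLM (p : ℝ≥0∞) [Fact (1 ≤ p)] (hz : z ∈ unitBall n) : LpBall n p →L[ℂ] ℂ :=
  LinearMap.mkContinuous
    { toFun := fun f => projFun f z
      map_add' := fun f g => by
        rw [projFun_congr_ae (Lp.coeFn_add f g),
          projFun_add (integrable_coeFn f) (integrable_coeFn g) hz]
      map_smul' := fun c f => by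
        rw [projFun_congr_ae (Lp.coeFn_smul c f), projFun_smul]
        rfl }
    (((1 - ‖z‖) ^ (n + 1))⁻¹) fun f => norm_projFun_le f (mem_unitBall.1 hz) le_rfl

theorem evalCLM_apply (hz : z ∈ unitBall n) (f : LpBall n p) : evalCLM p hz f = projFun f z := rfl

theorem continuousOn_uncurry_projFun :
    ContinuousOn (fun x : LpBall n p × Cn n => projFun x.1 x.2) (Set.univ ×ˢ unitBall n) := by
  rintro ⟨f, z⟩ ⟨-, hz⟩
  obtain ⟨r, hzr, hr⟩ := exists_between (mem_unitBall.1 hz)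
  have h_mem : Metric.ball (0 : Cn n) r ⊆ unitBall n := Metric.ball_subset_ball hr.le
  have hr_pos : 0 < 1 - r := sub_pos.2 hr
  have h_cont : ContinuousOn (fun x : LpBall n p × Cn n => projFun x.1 x.2)
      (Set.univ ×ˢ Metric.ball 0 r) := by
    refine continuousOn_prod_of_continuousOn_lipschitzOnWith _
      (Real.toNNReal ((1 - r) ^ (n + 1))⁻¹)
      (fun g _ => (differentiableOn_projFun (integrable_coeFn g)).continuousOn.mono h_mem)
      fun x hx => LipschitzOnWith.of_dist_le' fun g _ h _ => ?_
    rw [dist_eq_norm, dist_eq_norm, ← evalCLM_apply (h_mem hx), ← evalCLM_apply (h_mem hx),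
      ← map_sub]
    exact norm_projFun_le _ hr (mem_ball_zero_iff.1 hx).le
  exact (h_cont.continuousAt ((isOpen_univ.prod Metric.isOpen_ball).mem_nhds
    ⟨trivial, mem_ball_zero_iff.2 hzr⟩)).continuousWithinAt

theorem coeFn_ae_eq_projFun (g : bergmanSpace n p) :
    (g : LpBall n p) =ᵐ[vol n] projFun (g : LpBall n p) := by
  obtain ⟨h, h_diff, h_eq⟩ := g.2
  have h_int : Integrable h (vol n) := (integrable_coeFn (g : LpBall n p)).congr h_eq
  filter_upwards [h_eq, ae_mem_unitBall n] with z hz_eq hz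
  rw [projFun_congr_ae h_eq, projFun_eq_of_differentiableOn h_diff h_int hz, hz_eq]

theorem IsBergmanProjection.apply_coe {P : LpBall n p →L[ℂ] bergmanSpace n p}
    (hP : IsBergmanProjection P) (g : bergmanSpace n p) : P g = g :=
  Subtype.ext (Lp.ext ((hP g).trans (coeFn_ae_eq_projFun g).symm))

theorem IsBergmanProjection.apply_congr {P : LpBall n p →L[ℂ] bergmanSpace n p}
    (hP : IsBergmanProjection P) {f g : LpBall n p}
    (h : ∀ z ∈ unitBall n, projFun f z = projFun g z) : P f = P g := by
  refine Subtype.ext (Lp.ext ?_)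
  filter_upwards [hP f, hP g, ae_mem_unitBall n] with z hf hg hz
  rw [hf, hg]
  exact h z hz

/-- The integral kernel `(T K_w)(z)` of the operator `TP`. -/
def opKernel (T : bergmanSpace n p →L[ℂ] bergmanSpace n p) (z w : Cn n) : ℂ :=
  projFun (T (reproKernel n p w) : LpBall n p) z

theorem continuousOn_opKernel (T : bergmanSpace n p →L[ℂ] bergmanSpace n p) :
    ContinuousOn (fun x : Cn n × Cn n => opKernel T x.1 x.2) (unitBall n ×ˢ unitBall n) := by
  have h_kernel : ContinuousOn (fun w : Cn n => (T (reproKernel n p w) : LpBall n p))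
      (unitBall n) :=
    (continuous_subtype_val.comp T.continuous).comp_continuousOn continuousOn_reproKernel
  have h_snd : ContinuousOn (fun x : Cn n × Cn n => (T (reproKernel n p x.2) : LpBall n p))
      (unitBall n ×ˢ unitBall n) :=
    h_kernel.comp continuousOn_snd fun _ hx => hx.2
  have h_comp := continuousOn_uncurry_projFun.comp (h_snd.prodMk continuousOn_fst)
    fun _ hx => ⟨Set.mem_univ _, hx.1⟩
  simpa only [opKernel, Function.comp_def] using h_comp

theorem integrable_smul_reproKernel {f : LpBall n p} {r : ℝ} (hr : r < 1)
    (hf : ∀ᵐ w ∂(vol n), r < ‖w‖ → f w = 0) :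
    Integrable (fun w => f w • (reproKernel n p w : LpBall n p)) (vol n) := by
  refine Integrable.mono' ((integrable_coeFn f).norm.mul_const ((1 - r) ^ (n + 1))⁻¹) ?_ ?_
  · exact (Lp.aestronglyMeasurable f).smul (aestronglyMeasurable_vol_of_continuousOn
      (continuous_subtype_val.comp_continuousOn continuousOn_reproKernel))
  · filter_upwards [hf] with w hw
    rw [norm_smul]
    rcases le_or_gt ‖w‖ r with h_le | h_lt
    · exact mul_le_mul_of_nonneg_left (norm_reproKernel_le hr h_le) (norm_nonneg _)
    · simp [hw h_lt]

/-- The support condition makes `∫ f(w) K_w dv(w)` converge in `Lᵖ`, so that `T` may be applied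
under the integral sign. -/
theorem IsBergmanProjection.projFun_comp_apply {P : LpBall n p →L[ℂ] bergmanSpace n p}
    (hP : IsBergmanProjection P) (T : bergmanSpace n p →L[ℂ] bergmanSpace n p)
    {f : LpBall n p} {r : ℝ} (hr : r < 1) (hf : ∀ᵐ w ∂(vol n), r < ‖w‖ → f w = 0)
    (hz : z ∈ unitBall n) :
    projFun (T (P f) : LpBall n p) z = ∫ w, f w * opKernel T z w ∂(vol n) := by
  have h_int := integrable_smul_reproKernel hr hf
  set J : LpBall n p := ∫ w, f w • (reproKernel n p w : LpBall n p) ∂(vol n) with hJ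
  have hPJ : P f = P J := by
    refine hP.apply_congr fun x hx => ?_
    rw [← evalCLM_apply hx J, hJ, ← ContinuousLinearMap.integral_comp_comm _ h_int]
    refine integral_congr_ae ?_
    filter_upwards [ae_mem_unitBall n] with w hw
    rw [map_smul, evalCLM_apply, projFun_reproKernel hx hw, smul_eq_mul, mul_comm]
  set L : LpBall n p →L[ℂ] ℂ := evalCLM p hz ∘L (bergmanSpace n p).subtypeL ∘L T ∘L P
  have h_kernel : ∀ w, L (reproKernel n p w) = opKernel T z w := fun w => by
    change projFun (T (P (reproKernel n p w)) : LpBall n p) z = _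
    rw [hP.apply_coe, opKernel]
  calc projFun (T (P f) : LpBall n p) z = L J := by rw [hPJ]; rfl
    _ = ∫ w, L (f w • (reproKernel n p w : LpBall n p)) ∂(vol n) :=
        (L.integral_comp_comm h_int).symm
    _ = ∫ w, f w * opKernel T z w ∂(vol n) := by simp only [map_smul, h_kernel, smul_eq_mul]

theorem tendsto_mulInd (hp' : p ≠ ⊤) {B : ℕ → Set (Cn n)} (hB : ∀ m, MeasurableSet (B m))
    (h_mono : Monotone B) (h_cover : unitBall n ⊆ ⋃ m, B m) (f : LpBall n p) :
    Tendsto (fun m => mulInd (B m) (hB m) f) atTop (𝓝 f) := by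
  have h_null : vol n (⋂ m, (B m)ᶜ) = 0 := by
    rw [← Set.compl_iUnion]
    exact measure_mono_null (Set.compl_subset_compl.2 h_cover) (ae_mem_unitBall n)
  have h_measure : Tendsto (fun m => vol n (B m)ᶜ) atTop (𝓝 0) := by
    rw [← h_null]
    exact tendsto_measure_iInter_atTop (fun m => (hB m).compl.nullMeasurableSet)
      (fun _ _ h => Set.compl_subset_compl.2 (h_mono h)) ⟨0, measure_ne_top _ _⟩
  rw [Metric.tendsto_nhds]
  intro ε hε
  obtain ⟨η, hη, h_small⟩ := (Lp.memLp f).eLpNorm_indicator_le Fact.out hp' (half_pos hε)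
  filter_upwards [h_measure.eventually_le_const (ENNReal.ofReal_pos.2 hη)] with m hm
  rw [dist_comm, dist_eq_norm, ← mulInd_compl, Lp.norm_def,
    eLpNorm_congr_ae (coeFn_mulInd (hB m).compl f)]
  exact (ENNReal.toReal_le_of_le_ofReal (half_pos hε).le
    (h_small _ (hB m).compl hm)).trans_lt (half_lt_self hε)

theorem unitBall_subset_iUnion_closedBall (n : ℕ) :
    unitBall n ⊆ ⋃ m : ℕ, Metric.closedBall 0 (1 - 1 / ((m : ℝ) + 1)) := by
  intro z hz
  obtain ⟨m, hm⟩ := exists_nat_one_div_lt (sub_pos.2 (mem_unitBall.1 hz))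
  exact Set.mem_iUnion.2 ⟨m, mem_closedBall_zero_iff.2 (le_sub_comm.1 hm.le)⟩

theorem IsBergmanProjection.enorm_projFun_comp_le {P : LpBall n p →L[ℂ] bergmanSpace n p}
    (hP : IsBergmanProjection P) (hp' : p ≠ ⊤) (T : bergmanSpace n p →L[ℂ] bergmanSpace n p)
    (f : LpBall n p) (hz : z ∈ unitBall n) :
    ‖projFun (T (P f) : LpBall n p) z‖ₑ ≤ ∫⁻ w, ‖opKernel T z w‖ₑ * ‖f w‖ₑ ∂(vol n) := by
  set B : ℕ → Set (Cn n) := fun m => Metric.closedBall 0 (1 - 1 / ((m : ℝ) + 1))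
  have hB : ∀ m, MeasurableSet (B m) := fun m => Metric.isClosed_closedBall.measurableSet
  have h_mono : Monotone B := fun m m' h =>
    Metric.closedBall_subset_closedBall (sub_le_sub_left (Nat.one_div_le_one_div h) 1)
  set L : LpBall n p →L[ℂ] ℂ := evalCLM p hz ∘L (bergmanSpace n p).subtypeL ∘L T ∘L P
  have h_lim : Tendsto (fun m => ‖L (mulInd (B m) (hB m) f)‖ₑ) atTop (𝓝 ‖L f‖ₑ) :=
    ((L.continuous.tendsto f).comp (tendsto_mulInd hp' hB h_mono
      (unitBall_subset_iUnion_closedBall n) f)).enorm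
  refine le_of_tendsto' h_lim fun m => ?_
  have h_supp : ∀ᵐ w ∂(vol n), 1 - 1 / ((m : ℝ) + 1) < ‖w‖ → mulInd (B m) (hB m) f w = 0 := by
    filter_upwards [coeFn_mulInd (hB m) f] with w h_ind hw
    rw [h_ind, Set.indicator_of_notMem]
    exact fun h => hw.not_ge (mem_closedBall_zero_iff.1 h)
  have h_repr : L (mulInd (B m) (hB m) f) = ∫ w, mulInd (B m) (hB m) f w * opKernel T z w ∂vol n :=
    hP.projFun_comp_apply T (sub_lt_self 1 (by positivity)) h_supp hz
  rw [h_repr]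
  refine (enorm_integral_le_lintegral_enorm _).trans (lintegral_mono_ae ?_)
  filter_upwards [coeFn_mulInd (hB m) f] with w h_ind
  rw [enorm_mul, mul_comm, h_ind]
  gcongr
  exact enorm_indicator_le_enorm_self _ _

end OperatorKernel

/-! ### Decay off the diagonal -/

section Metric

variable {n : ℕ} {z w : Cn n} {r : ℝ}

theorem rho_comm (hz : z ∈ unitBall n) (hw : w ∈ unitBall n) : rho z w = rho w z := by
  have h_zw := one_sub_norm_sq_moebius hz hw
  have h_norm : ‖(1 - inner ℂ z w : ℂ)‖ = ‖(1 - inner ℂ w z : ℂ)‖ := by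
    rw [← inner_conj_symm w z, ← RCLike.norm_conj]
    simp
  rw [h_norm, mul_comm, ← one_sub_norm_sq_moebius hw hz] at h_zw
  exact (pow_left_inj₀ (norm_nonneg _) (norm_nonneg _) two_ne_zero).1 (sub_right_injective h_zw)

theorem beta_comm (hz : z ∈ unitBall n) (hw : w ∈ unitBall n) : beta z w = beta w z := by
  rw [beta, beta, rho_comm hz hw]

theorem measurable_beta (n : ℕ) : Measurable fun x : Cn n × Cn n => beta x.1 x.2 := by
  unfold beta rho moebius
  fun_prop

theorem measurableSet_D (z : Cn n) (r : ℝ) : MeasurableSet (D z r) :=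
  (measurableSet_unitBall n).inter
    (measurableSet_le ((measurable_beta n).comp measurable_prodMk_left) measurable_const)

theorem mem_sdiff_D : w ∈ unitBall n \ D z r ↔ w ∈ unitBall n ∧ r < beta z w := by
  refine and_congr_right fun hw => ?_
  simp only [D, Set.mem_ofPred_eq, hw, true_and, not_le]

theorem lt_beta_of_notMem_nhd {F : Set (Cn n)} (hz : z ∈ F) (hw : w ∈ unitBall n)
    (h : w ∉ nhd r F) : r < beta z w := by
  by_contra! h_le
  exact h ⟨hw, (iInf₂_le z hz).trans (ENNReal.ofReal_le_ofReal h_le)⟩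

end Metric

section SchurIntegral

variable {n : ℕ} {z w : Cn n} {q δ : ℝ}

theorem normK_rpow_expo (hq : q ≠ 0) (hz : z ∈ unitBall n) :
    normK z ^ expo n q δ
      = ((1 - ‖z‖ ^ 2) ^ (((n : ℝ) + 1) / 2))⁻¹ * (1 - ‖z‖ ^ 2) ^ (δ / q) := by
  have hs := one_sub_norm_sq_pos hz
  rw [normK_eq hz, ← Real.rpow_mul hs.le, ← Real.rpow_neg hs.le, ← Real.rpow_add hs, expo]
  congr 1
  field_simp
  ring

theorem rpow_half_mul_self (hz : z ∈ unitBall n) :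
    (1 - ‖z‖ ^ 2) ^ (((n : ℝ) + 1) / 2) * (1 - ‖z‖ ^ 2) ^ (((n : ℝ) + 1) / 2)
      = (1 - ‖z‖ ^ 2) ^ (n + 1) := by
  rw [← Real.rpow_add (one_sub_norm_sq_pos hz), add_halves,
    ← Real.rpow_natCast _ (n + 1), Nat.cast_add_one]

/-- The exponents in the definition of weak localization are the ones of the Schur test with the
weight `(1 - |w|²)^(-δ/q)`, up to the factors by which `k_z` and `K_z` differ. -/
theorem lintegral_mul_weight_eq_schurInt {M : Cn n → Cn n → ℂ} {t : Cn n → ℂ} (hq : q ≠ 0)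
    (hz : z ∈ unitBall n) {E : Set (Cn n)} (hE : MeasurableSet E) (h_sub : E ⊆ unitBall n)
    (hM : ∀ w ∈ E, ‖M z w‖ =
      (1 - ‖z‖ ^ 2) ^ (((n : ℝ) + 1) / 2) * (1 - ‖w‖ ^ 2) ^ (((n : ℝ) + 1) / 2) * ‖t w‖) :
    ∫⁻ w in E, ‖t w‖ₑ * ENNReal.ofReal ((1 - ‖w‖ ^ 2) ^ (-(δ / q))) ∂(vol n)
      = schurInt M (expo n q δ) z E * ENNReal.ofReal ((1 - ‖z‖ ^ 2) ^ (-(δ / q))) := by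
  have hs := one_sub_norm_sq_pos hz
  rw [schurInt, invVol, setLIntegral_withDensity_eq_setLIntegral_mul_non_measurable _ (by fun_prop)
    _ hE (Eventually.of_forall fun _ => ENNReal.ofReal_lt_top),
    ← lintegral_mul_const' _ _ ENNReal.ofReal_ne_top]
  refine setLIntegral_congr_fun hE fun w hw => ?_
  have hsw := one_sub_norm_sq_pos (h_sub hw)
  rw [Pi.mul_apply, hM w hw, normK_rpow_expo hq hz, normK_rpow_expo hq (h_sub hw),
    ← rpow_half_mul_self (h_sub hw), ← ENNReal.ofReal_mul (by positivity),
    ← ENNReal.ofReal_mul (by positivity), ← ofReal_norm, ← ENNReal.ofReal_mul (norm_nonneg _),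
    Real.rpow_neg hs.le, Real.rpow_neg hsw.le]
  congr 1
  field_simp

end SchurIntegral

section OffDiagonal

variable {n : ℕ} {p : ℝ≥0∞} [Fact (1 ≤ p)] {T : bergmanSpace n p →L[ℂ] bergmanSpace n p}
  {z w : Cn n} {r δ : ℝ}

theorem pairing_k (g : Cn n → ℂ) (w : Cn n) :
    pairing g (k w) = (((1 - ‖w‖ ^ 2) ^ (((n : ℝ) + 1) / 2) : ℝ) : ℂ) * projFun g w := by
  rw [pairing, projFun, ← integral_const_mul]
  refine integral_congr_ae (Eventually.of_forall fun x => ?_)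
  simp only [k, map_mul, Complex.conj_ofReal, conj_K]
  ring

theorem norm_entry (T : bergmanSpace n p →L[ℂ] bergmanSpace n p) (hz : z ∈ unitBall n)
    (hw : w ∈ unitBall n) : ‖entry T z w‖ =
      (1 - ‖z‖ ^ 2) ^ (((n : ℝ) + 1) / 2) * (1 - ‖w‖ ^ 2) ^ (((n : ℝ) + 1) / 2) *
        ‖opKernel T w z‖ := by
  have hs := one_sub_norm_sq_pos hz
  have hsw := one_sub_norm_sq_pos hw
  rw [entry, pairing_k, kernel_eq_smul_reproKernel hz, map_smul, Submodule.coe_smul,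
    ← evalCLM_apply hw, map_smul, evalCLM_apply, norm_mul, norm_smul, Complex.norm_real,
    Complex.norm_real, Real.norm_of_nonneg (by positivity), Real.norm_of_nonneg (by positivity),
    opKernel]
  ring

theorem norm_adjEntry (T : bergmanSpace n p →L[ℂ] bergmanSpace n p) (z w : Cn n) :
    ‖adjEntry T z w‖ = ‖entry T w z‖ := by
  rw [adjEntry, entry, pairing, pairing, ← RCLike.norm_conj, ← integral_conj]
  simp only [map_mul, RCLike.conj_conj, mul_comm]

/-- The absolute value of the kernel of `TP`, cut off to the pairs of points of the ball at
distance more than `r`. -/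
def farKernel (T : bergmanSpace n p →L[ℂ] bergmanSpace n p) (r : ℝ) (z w : Cn n) : ℝ≥0∞ :=
  ({x : Cn n × Cn n | r < beta x.1 x.2} ∩ unitBall n ×ˢ unitBall n).indicator
    (fun x => ‖opKernel T x.1 x.2‖ₑ) (z, w)

theorem farKernel_of_lt (hz : z ∈ unitBall n) (hw : w ∈ unitBall n) (h : r < beta z w) :
    farKernel T r z w = ‖opKernel T z w‖ₑ := by
  rw [farKernel, Set.indicator_of_mem]
  exact ⟨h, hz, hw⟩

theorem measurable_farKernel (T : bergmanSpace n p →L[ℂ] bergmanSpace n p) (r : ℝ) :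
    Measurable (Function.uncurry (farKernel T r)) := by
  classical
  have h_ball : Measurable ((unitBall n ×ˢ unitBall n).indicator
      fun x : Cn n × Cn n => ‖opKernel T x.1 x.2‖ₑ) := by
    rw [← Set.piecewise_eq_indicator]
    exact ContinuousOn.measurable_piecewise (continuousOn_opKernel T).enorm continuousOn_const
      ((measurableSet_unitBall n).prod (measurableSet_unitBall n))
  change Measurable (Set.indicator _ _)
  rw [← Set.indicator_indicator]
  exact h_ball.indicator (measurableSet_lt measurable_const (measurable_beta n))

theorem farKernel_eq_indicator_right (T : bergmanSpace n p →L[ℂ] bergmanSpace n p) (r : ℝ)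
    (hz : z ∈ unitBall n) (w : Cn n) :
    farKernel T r z w = (unitBall n \ D z r).indicator (fun w => ‖opKernel T z w‖ₑ) w := by
  classical
  simp only [farKernel, Set.indicator_apply, mem_sdiff_D]
  refine if_congr ?_ rfl rfl
  simp only [Set.mem_inter_iff, Set.mem_ofPred_eq, Set.mem_prod, hz, true_and, and_comm]

theorem farKernel_eq_indicator_left (T : bergmanSpace n p →L[ℂ] bergmanSpace n p) (r : ℝ)
    (hw : w ∈ unitBall n) (z : Cn n) :
    farKernel T r z w = (unitBall n \ D w r).indicator (fun z => ‖opKernel T z w‖ₑ) z := by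
  classical
  simp only [farKernel, Set.indicator_apply, mem_sdiff_D]
  refine if_congr ?_ rfl rfl
  simp only [Set.mem_inter_iff, Set.mem_ofPred_eq, Set.mem_prod, hw, and_true]
  exact and_comm.trans (and_congr_right fun hz => by rw [beta_comm hz hw])

theorem lintegral_farKernel_right {q : ℝ} (hq : q ≠ 0) (hz : z ∈ unitBall n) :
    ∫⁻ w, farKernel T r z w * ENNReal.ofReal ((1 - ‖w‖ ^ 2) ^ (-(δ / q))) ∂(vol n)
      = schurInt (adjEntry T) (expo n q δ) z (unitBall n \ D z r)
        * ENNReal.ofReal ((1 - ‖z‖ ^ 2) ^ (-(δ / q))) := by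
  have h_meas := (measurableSet_unitBall n).diff (measurableSet_D z r)
  rw [← lintegral_mul_weight_eq_schurInt (t := opKernel T z) hq hz h_meas Set.sdiff_subset
    fun w hw => by rw [norm_adjEntry, norm_entry T hw.1 hz, mul_comm (_ ^ _ : ℝ)],
    ← lintegral_indicator h_meas]
  simp only [farKernel_eq_indicator_right T r hz, Set.indicator_mul_left]

theorem lintegral_farKernel_left {q : ℝ} (hq : q ≠ 0) (hw : w ∈ unitBall n) :
    ∫⁻ z, farKernel T r z w * ENNReal.ofReal ((1 - ‖z‖ ^ 2) ^ (-(δ / q))) ∂(vol n)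
      = schurInt (entry T) (expo n q δ) w (unitBall n \ D w r)
        * ENNReal.ofReal ((1 - ‖w‖ ^ 2) ^ (-(δ / q))) := by
  have h_meas := (measurableSet_unitBall n).diff (measurableSet_D w r)
  rw [← lintegral_mul_weight_eq_schurInt (t := fun z => opKernel T z w) hq hw h_meas
    Set.sdiff_subset fun z hz => norm_entry T hw hz.1, ← lintegral_indicator h_meas]
  simp only [farKernel_eq_indicator_left T r hw, Set.indicator_mul_left]

/-- The vanishing condition in the definition of weak localization, for an arbitrary real `δ`. -/
def HasVanishingTails (T : bergmanSpace n p →L[ℂ] bergmanSpace n p) : Prop :=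
  ∃ δ : ℝ,
    Tendsto (fun r : ℝ => ⨆ z ∈ unitBall n,
      schurInt (entry T) (expo n p.toReal.conjExponent δ) z (unitBall n \ D z r)) atTop (𝓝 0) ∧
    Tendsto (fun r : ℝ => ⨆ z ∈ unitBall n,
      schurInt (adjEntry T) (expo n p.toReal δ) z (unitBall n \ D z r)) atTop (𝓝 0)

theorem IsWeaklyLocalized.hasVanishingTails (hT : IsWeaklyLocalized T) : HasVanishingTails T :=
  let ⟨δ, _, _, h_tails⟩ := hT.vanishing
  ⟨δ, h_tails⟩

theorem HasVanishingTails.exists_lintegral_farKernel_le (hT : HasVanishingTails T) (hp : 1 < p)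
    (hp' : p ≠ ⊤) {ε : ℝ≥0∞} (hε : 0 < ε) :
    ∃ r : ℝ, 0 < r ∧ ∀ f : Cn n → ℝ≥0∞, Measurable f →
      ∫⁻ z, (∫⁻ w, farKernel T r z w * f w ∂(vol n)) ^ p.toReal ∂(vol n)
        ≤ ε ^ p.toReal * ∫⁻ w, f w ^ p.toReal ∂(vol n) := by
  have hpq := holderConjugate_toReal hp hp'
  obtain ⟨δ, h_entry, h_adj⟩ := hT
  set q := p.toReal.conjExponent
  obtain ⟨r, ⟨hr_entry, hr_adj⟩, hr⟩ := (((h_entry.eventually_le_const hε).and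
    (h_adj.eventually_le_const hε)).and (eventually_gt_atTop (0 : ℝ))).exists
  have h_pow : ε ^ (p.toReal / q) * ε = ε ^ p.toReal := by
    rw [hpq.div_conj_eq_sub_one]
    nth_rw 2 [← ENNReal.rpow_one ε]
    rw [← ENNReal.rpow_add_of_nonneg _ _ hpq.sub_one_pos.le zero_le_one, sub_add_cancel]
  refine ⟨r, hr, fun f hf => h_pow ▸ lintegral_rpow_le_of_weight (δ := δ) hpq
    (measurable_farKernel T r) hf (fun z hz => ?_) fun w hw => ?_⟩
  · rw [lintegral_farKernel_right hpq.ne_zero hz]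
    gcongr
    exact (iSup₂_le_iff.1 hr_adj) z hz
  · rw [lintegral_farKernel_left hpq.symm.ne_zero hw]
    gcongr
    exact (iSup₂_le_iff.1 hr_entry) w hw

end OffDiagonal

/-! ### Localization -/

section Localization

variable {n N : ℕ} {p : ℝ≥0∞} [Fact (1 ≤ p)] {P : LpBall n p →L[ℂ] bergmanSpace n p}
  {T T' : bergmanSpace n p →L[ℂ] bergmanSpace n p} {S S' : LpBall n p →L[ℂ] LpBall n p}
  {r : ℝ} {F : ℕ → Set (Cn n)}

/-- The operator `TP`, regarded as an operator on `Lᵖ`. -/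
def compProj (T : bergmanSpace n p →L[ℂ] bergmanSpace n p)
    (P : LpBall n p →L[ℂ] bergmanSpace n p) : LpBall n p →L[ℂ] LpBall n p :=
  (bergmanSpace n p).subtypeL ∘L T ∘L P

theorem norm_compProj_sub_le (P : LpBall n p →L[ℂ] bergmanSpace n p)
    (T T' : bergmanSpace n p →L[ℂ] bergmanSpace n p) :
    ‖compProj T P - compProj T' P‖ ≤ ‖T - T'‖ * ‖P‖ :=
  ContinuousLinearMap.opNorm_le_bound _ (by positivity) fun f => calc
    ‖(compProj T P - compProj T' P) f‖ = ‖(T - T') (P f)‖ := rfl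
    _ ≤ ‖T - T'‖ * ‖P‖ * ‖f‖ := by
      rw [mul_assoc]
      exact (T - T').le_opNorm_of_le (P.le_opNorm f)

theorem IsBorelCovering.ae_enorm_sub_apply_le (hF : IsBorelCovering n N r F) (hp' : p ≠ ⊤)
    (hP : IsBergmanProjection P)
    (hS : IsBlockSum hF.measurable (fun j => measurableSet_nhd r (hF.subset j)) (compProj T P) S)
    (f : LpBall n p) :
    ∀ᵐ z ∂(vol n), ‖(compProj T P - S) f z‖ₑ ≤ ∫⁻ w, farKernel T r z w * ‖f w‖ₑ ∂(vol n) := by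
  have hG := fun j => measurableSet_nhd r (hF.subset j)
  set g := fun j => mulInd (nhd r (F j))ᶜ (hG j).compl f
  have h_eq := ae_all_iff.2 fun j => coeFn_ae_eq_projFun (T (P (g j)))
  filter_upwards [hS.ae_sub_apply_eq hF.disjoint f, h_eq, ae_mem_unitBall n] with z h_loc h_proj hz
  obtain ⟨j, hj⟩ := Set.mem_iUnion.1 (hF.cover ▸ hz)
  calc ‖(compProj T P - S) f z‖ₑ = ‖projFun (T (P (g j)) : LpBall n p) z‖ₑ := by
        rw [h_loc j hj, ← h_proj j]
        rfl
    _ ≤ ∫⁻ w, ‖opKernel T z w‖ₑ * ‖g j w‖ₑ ∂(vol n) := hP.enorm_projFun_comp_le hp' T (g j) hz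
    _ ≤ ∫⁻ w, farKernel T r z w * ‖f w‖ₑ ∂(vol n) := by
      refine lintegral_mono_ae ?_
      filter_upwards [coeFn_mulInd (hG j).compl f, ae_mem_unitBall n] with w h_ind hw
      rw [h_ind]
      by_cases h : w ∈ nhd r (F j)
      · rw [Set.indicator_of_notMem (Set.notMem_compl_iff.2 h), enorm_zero, mul_zero]
        exact zero_le
      · rw [Set.indicator_of_mem (Set.mem_compl h),
          farKernel_of_lt hz hw (lt_beta_of_notMem_nhd hj hw h)]

theorem IsBorelCovering.norm_sub_le (hF : IsBorelCovering n N r F) (hp' : p ≠ ⊤)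
    (hP : IsBergmanProjection P)
    (hS : IsBlockSum hF.measurable (fun j => measurableSet_nhd r (hF.subset j)) (compProj T P) S)
    {ε : ℝ} (hε : 0 ≤ ε)
    (h_far : ∀ f : Cn n → ℝ≥0∞, Measurable f →
      ∫⁻ z, (∫⁻ w, farKernel T r z w * f w ∂(vol n)) ^ p.toReal ∂(vol n)
        ≤ ENNReal.ofReal ε ^ p.toReal * ∫⁻ w, f w ^ p.toReal ∂(vol n)) :
    ‖compProj T P - S‖ ≤ ε := by
  refine ContinuousLinearMap.opNorm_le_bound _ hε fun f => ?_
  have hp₀ := toReal_pos_of_fact hp'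
  have h_rpow : ‖(compProj T P - S) f‖ₑ ^ p.toReal ≤ (ENNReal.ofReal ε * ‖f‖ₑ) ^ p.toReal := by
    rw [ENNReal.mul_rpow_of_nonneg _ _ hp₀.le, enorm_rpow_eq_lintegral hp',
      enorm_rpow_eq_lintegral hp']
    refine (lintegral_mono_ae ?_).trans (h_far _ (Lp.stronglyMeasurable f).enorm)
    filter_upwards [hF.ae_enorm_sub_apply_le hp' hP hS f] with z hz
    gcongr
  have h_enorm := (ENNReal.rpow_le_rpow_iff hp₀).1 h_rpow
  rwa [← ofReal_norm, ← ofReal_norm, ← ENNReal.ofReal_mul hε,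
    ENNReal.ofReal_le_ofReal_iff (by positivity)] at h_enorm

theorem HasVanishingTails.exists_norm_sub_le (hT : HasVanishingTails T) (hp : 1 < p) (hp' : p ≠ ⊤)
    (hP : IsBergmanProjection P) {ε : ℝ} (hε : 0 < ε) :
    ∃ r : ℝ, 0 < r ∧ ∀ (N : ℕ) (F : ℕ → Set (Cn n)) (hF : IsBorelCovering n N r F)
      (S : LpBall n p →L[ℂ] LpBall n p),
      IsBlockSum hF.measurable (fun j => measurableSet_nhd r (hF.subset j)) (compProj T P) S →
        ‖compProj T P - S‖ ≤ ε :=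
  let ⟨r, hr, h_far⟩ := hT.exists_lintegral_farKernel_le hp hp' (ENNReal.ofReal_pos.2 hε)
  ⟨r, hr, fun _ _ hF _ hS => hF.norm_sub_le hp' hP hS hε.le h_far⟩

theorem exists_norm_sub_isBlockSum_lt (hp : 1 < p) (hp' : p ≠ ⊤) (hP : IsBergmanProjection P)
    (hT : T ∈ closure {T | HasVanishingTails T}) (N : ℕ) {ε : ℝ} (hε : 0 < ε) :
    ∃ r : ℝ, 0 < r ∧ ∀ (F : ℕ → Set (Cn n)) (hF : IsBorelCovering n N r F),
      ∃ S, IsBlockSum hF.measurable (fun j => measurableSet_nhd r (hF.subset j)) (compProj T P) S ∧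
        ‖compProj T P - S‖ < ε := by
  set c : ℝ := (N : ℝ) ^ (1 / p.toReal)
  have h_pos : 0 < (1 + c) * ‖P‖ + 1 := by positivity
  obtain ⟨T', hT', h_dist⟩ := (Metric.mem_closure_iff
    (α := bergmanSpace n p →L[ℂ] bergmanSpace n p)).1 hT (ε / 2 / ((1 + c) * ‖P‖ + 1))
    (by positivity)
  have h_near : ‖T - T'‖ * ((1 + c) * ‖P‖ + 1) < ε / 2 :=
    (lt_div_iff₀ h_pos).1 ((dist_eq_norm T T').symm.trans_lt h_dist)
  obtain ⟨r, hr, h_tail⟩ := hT'.exists_norm_sub_le hp hp' hP (half_pos hε)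
  refine ⟨r, hr, fun F hF => ?_⟩
  have h_exists := exists_isBlockSum hp' hF.measurable hF.disjoint
    (fun j => measurableSet_nhd r (hF.subset j)) hF.multiplicity
  obtain ⟨S, hS⟩ := h_exists (compProj T P)
  obtain ⟨S', hS'⟩ := h_exists (compProj T' P)
  refine ⟨S, hS, ?_⟩
  have h_sub := norm_compProj_sub_le P T T'
  have h_block := (hS.sub hS').norm_le hp' hF.disjoint hF.multiplicity
  calc ‖compProj T P - S‖
      = ‖(compProj T P - compProj T' P) + (compProj T' P - S') - (S - S')‖ := by congr 1; abel
    _ ≤ ‖compProj T P - compProj T' P‖ + ‖compProj T' P - S'‖ + ‖S - S'‖ :=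
      (norm_sub_le _ _).trans (add_le_add_left (norm_add_le _ _) _)
    _ ≤ ‖T - T'‖ * ‖P‖ + ε / 2 + c * (‖T - T'‖ * ‖P‖) := by
      gcongr
      · exact h_tail N F hF S' hS'
      · exact h_block.trans (by gcongr)
    _ = ‖T - T'‖ * ((1 + c) * ‖P‖) + ε / 2 := by ring
    _ < ε := by linarith [norm_nonneg (T - T')]

end Localization

end Bergman

theorem proposition2p5_general (n : ℕ) (p : ℝ≥0∞) [Fact (1 ≤ p)] (hp : 1 < p) (hp' : p ≠ ⊤) :
    ∃ P : Bergman.LpBall n p →L[ℂ] Bergman.bergmanSpace n p,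
      Bergman.IsBergmanProjection P ∧
      ∀ T ∈ closure {T : Bergman.bergmanSpace n p →L[ℂ] Bergman.bergmanSpace n p |
          Bergman.HasVanishingTails T}, ∀ N : ℕ, ∀ ε : ℝ, 0 < ε →
        ∃ r : ℝ, 0 < r ∧
          ∀ (F : ℕ → Set (Bergman.Cn n)) (hF : Bergman.IsBorelCovering n N r F),
            ∃ S : Bergman.bergmanSpace n p →L[ℂ] Bergman.LpBall n p,
              (∀ f : Bergman.bergmanSpace n p,
                HasSum (fun j : ℕ =>
                  Bergman.mulInd (F j) (hF.measurable j)
                    (T (P (Bergman.mulInd (Bergman.nhd r (F j))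
                      (Bergman.measurableSet_nhd r (hF.subset j)) f)))) (S f)) ∧
              ‖(Bergman.bergmanSpace n p).subtypeL ∘L T ∘L P ∘L (Bergman.bergmanSpace n p).subtypeL
                  - S‖ < ε := by
  obtain ⟨P, hP⟩ := Bergman.exists_isBergmanProjection n hp hp'
  refine ⟨P, hP, fun T hT N ε hε => ?_⟩
  obtain ⟨r, hr, h_cov⟩ := Bergman.exists_norm_sub_isBlockSum_lt hp hp' hP hT N hε
  refine ⟨r, hr, fun F hF => ?_⟩
  obtain ⟨S, hS, h_lt⟩ := h_cov F hF
  set ι := (Bergman.bergmanSpace n p).subtypeL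
  refine ⟨S ∘L ι, fun f => hS f, ?_⟩
  calc ‖(Bergman.compProj T P - S) ∘L ι‖ ≤ ‖Bergman.compProj T P - S‖ * ‖ι‖ :=
        ContinuousLinearMap.opNorm_comp_le _ _
    _ ≤ ‖Bergman.compProj T P - S‖ :=
      mul_le_of_le_one_right (norm_nonneg _) (Bergman.bergmanSpace n p).norm_subtypeL_le
    _ < ε := h_lt

end

theorem proposition2p5 (n : ℕ) (hn : 1 ≤ n) (p : ℝ≥0∞) [Fact (1 ≤ p)] (hp : 1 < p) (hp' : p ≠ ⊤) :
    ∃ P : Bergman.LpBall n p →L[ℂ] Bergman.bergmanSpace n p,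
      Bergman.IsBergmanProjection P ∧
      ∀ T ∈ closure (Bergman.weaklyLocalized n p), ∀ N : ℕ, ∀ ε : ℝ, 0 < ε →
        ∃ r : ℝ, 0 < r ∧
          ∀ (F : ℕ → Set (Bergman.Cn n)) (hF : Bergman.IsBorelCovering n N r F),
            ∃ S : Bergman.bergmanSpace n p →L[ℂ] Bergman.LpBall n p,
              (∀ f : Bergman.bergmanSpace n p,
                HasSum (fun j : ℕ =>
                  Bergman.mulInd (F j) (hF.measurable j)
                    (T (P (Bergman.mulInd (Bergman.nhd r (F j))
                      (Bergman.measurableSet_nhd r (hF.subset j)) f)))) (S f)) ∧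
              ‖(Bergman.bergmanSpace n p).subtypeL ∘L T ∘L P ∘L (Bergman.bergmanSpace n p).subtypeL
                  - S‖ < ε := by
  obtain ⟨P, hP, h⟩ := proposition2p5_general n p hp hp'
  exact ⟨P, hP, fun T hT => h T (closure_mono (fun _ h_loc => h_loc.hasVanishingTails) hT)⟩
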